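/- Let $n\ge 1$ and let $\mathfrak g=Q(n)$ be the queer Lie superalgebra over $\mathbb C$, i.e. the Lie subsuperalgebra of $\mathfrak{gl}(n|n)$ of all block matrices $\left(\begin{smallmatrix}A&B\\B&A\end{smallmatrix}\right)$ with $A,B\in \mathrm{Mat}_n(\mathbb C)$. Let $e_{i,j}$ (resp. $f_{i,j}$) be the element with $A=E_{ij}$, $B=0$ (resp. $A=0$, $B=E_{ij}$), and put $\operatorname{otr}\left(\begin{smallmatrix}A&B\\C&D\end{smallmatrix}\right)=\operatorname{tr}B$. Let $\chi\in\mathfrak g^*$ be the regular nilpotent even functional $\chi(x)=\operatorname{otr}(xE)$, where $E=\sum_{i=1}^{n-1}f_{i,i+1}$. Let $h\in\mathfrak g_{\bar 0}$ be the element with $A=\operatorname{diag}(n-1,n-3,\dots,1-n)$, $B=0$, let $\mathfrak g_j=\{x\in\mathfrak g : [h,x]=jx\}$, and let $\mathfrak m=\bigoplus_{j=1}^{n-1}\mathfrak g_{-2j}$. Let $I_\chi$ be the left ideal of the universal enveloping superalgebra $U(\mathfrak g)$ generated by $a-\chi(a)$, $a\in\mathfrak m$, let $Q_\chi=U(\mathfrak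 g)/I_\chi$ with projection $\pi:U(\mathfrak g)\to Q_\chi$, and let $W_\chi=\operatorname{End}_{U(\mathfrak g)}(Q_\chi)^{op}$ be the finite $W$-algebra. Via $\varphi\mapsto\varphi(\pi(1))$, $W_\chi$ is identified with $\{v\in Q_\chi : av=\chi(a)v \text{ for all } a\in\mathfrak m\}$, with product $\pi(y_1)\pi(y_2)=\pi(y_1y_2)$. Define $e_{i,j}^{(m)},f_{i,j}^{(m)}\in U(\mathfrak g)$ for $m\ge 1$ by $e_{i,j}^{(1)}=e_{i,j}$, $f_{i,j}^{(1)}=f_{i,j}$ and, for $m\ge 2$, $$e_{i,j}^{(m)}=\sum_{k=1}^n e_{i,k}e_{k,j}^{(m-1)}+(-1)^{m+1}\sum_{k=1}^n f_{i,k}f_{k,j}^{(m-1)},\qquad f_{i,j}^{(m)}=\sum_{k=1}^n e_{i,k}f_{k,j}^{(m-1)}+(-1)^{m+1}\sum_{k=1}^n f_{i,k}e_{k,j}^{(m-1)}.$$ Then the elements $\pi(e_{n,1}^{(m)})$ and $\pi(f_{n,1}^{(m)})$ for $m=n,\dots,2n-1$ lie in $W_\chi$ and generate $W_\chi$ as an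 algebra. Moreover, the natural algebra homomorphism $U(\mathfrak g)^{\operatorname{ad}\mathfrak m}\to W_\chi$, $u\mapsto\pi(u)$, is surjective, where $U(\mathfrak g)^{\operatorname{ad}\mathfrak m}$ is the subalgebra of all $u\in U(\mathfrak g)$ with $\operatorname{ad}(a)(u)=0$ for all $a\in\mathfrak m$, and $\operatorname{ad}(a)(u)=au-(-1)^{|a||u|}ua$ for homogeneous $a$, $u$. -/

import Mathlib

noncomputable section

namespace QueerW

open Matrix

/-- Square complex matrices of size `2n`, written in four `n × n` blocks: the space `gl(n|n)`. -/
abbrev BlockMat (n : ℕ) := Matrix (Fin n ⊕ Fin n) (Fin n ⊕ Fin n) ℂ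

/-- The even (block diagonal) component of a block matrix. -/
def evenPart (n : ℕ) : BlockMat n →ₗ[ℂ] BlockMat n where
  toFun X := fromBlocks X.toBlocks₁₁ 0 0 X.toBlocks₂₂
  map_add' X Y := by
    ext (i | i) (j | j) <;> simp [toBlocks₁₁, toBlocks₂₂]
  map_smul' c X := by
    ext (i | i) (j | j) <;> simp [toBlocks₁₁, toBlocks₂₂]

/-- The odd (block off-diagonal) component of a block matrix. -/
def oddPart (n : ℕ) : BlockMat n →ₗ[ℂ] BlockMat n where
  toFun X := fromBlocks 0 X.toBlocks₁₂ X.toBlocks₂₁ 0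
  map_add' X Y := by
    ext (i | i) (j | j) <;> simp [toBlocks₁₂, toBlocks₂₁]
  map_smul' c X := by
    ext (i | i) (j | j) <;> simp [toBlocks₁₂, toBlocks₂₁]

@[simp] theorem evenPart_fromBlocks {n : ℕ} (A B C D : Matrix (Fin n) (Fin n) ℂ) :
    evenPart n (fromBlocks A B C D) = fromBlocks A 0 0 D := by
  simp [evenPart]

@[simp] theorem oddPart_fromBlocks {n : ℕ} (A B C D : Matrix (Fin n) (Fin n) ℂ) :
    oddPart n (fromBlocks A B C D) = fromBlocks 0 B C 0 := by
  simp [oddPart]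

/-- The supercommutator of `gl(n|n)`: the bilinear extension of
`[X, Y] = X Y - (-1)^{|X||Y|} Y X` from homogeneous `X`, `Y`. -/
def superBracket {n : ℕ} (X Y : BlockMat n) : BlockMat n :=
  X * Y - evenPart n Y * X - oddPart n Y * evenPart n X + oddPart n Y * oddPart n X

/-- The queer Lie superalgebra `Q(n)`, inside `gl(n|n)`. -/
def queer (n : ℕ) : Submodule ℂ (BlockMat n) where
  carrier := {X | ∃ A B : Matrix (Fin n) (Fin n) ℂ, X = fromBlocks A B B A}
  add_mem' := by
    rintro _ _ ⟨A, B, rfl⟩ ⟨A', B', rfl⟩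
    exact ⟨A + A', B + B', by simp [fromBlocks_add]⟩
  zero_mem' := ⟨0, 0, by simp⟩
  smul_mem' := by
    rintro c _ ⟨A, B, rfl⟩
    exact ⟨c • A, c • B, by simp [fromBlocks_smul]⟩

theorem superBracket_fromBlocks {n : ℕ} (A B A' B' : Matrix (Fin n) (Fin n) ℂ) :
    superBracket (fromBlocks A B B A) (fromBlocks A' B' B' A') =
      fromBlocks (A * A' - A' * A + (B * B' + B' * B)) (A * B' - B' * A + (B * A' - A' * B))
        (A * B' - B' * A + (B * A' - A' * B)) (A * A' - A' * A + (B * B' + B' * B)) := by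
  simp only [superBracket, evenPart_fromBlocks, oddPart_fromBlocks, fromBlocks_multiply,
    sub_eq_add_neg, fromBlocks_neg, fromBlocks_add]
  congr 1 <;> simp <;> abel

instance (n : ℕ) : Bracket (queer n) (queer n) where
  bracket X Y := ⟨superBracket (X : BlockMat n) (Y : BlockMat n), by
    obtain ⟨_, A, B, rfl⟩ := X
    obtain ⟨_, A', B', rfl⟩ := Y
    exact ⟨_, _, superBracket_fromBlocks A B A' B'⟩⟩

theorem coe_bracket {n : ℕ} (X Y : queer n) :
    ((⁅X, Y⁆ : queer n) : BlockMat n) = superBracket (X : BlockMat n) (Y : BlockMat n) := rfl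

/-- The element of `Q(n)` with diagonal blocks `A` and off-diagonal blocks `B`. -/
def block {n : ℕ} (A B : Matrix (Fin n) (Fin n) ℂ) : queer n := ⟨fromBlocks A B B A, A, B, rfl⟩

theorem exists_block {n : ℕ} (x : queer n) :
    ∃ A B : Matrix (Fin n) (Fin n) ℂ, x = block A B := by
  obtain ⟨_, A, B, rfl⟩ := x
  exact ⟨A, B, rfl⟩

theorem block_add {n : ℕ} (A B A' B' : Matrix (Fin n) (Fin n) ℂ) :
    block A B + block A' B' = block (A + A') (B + B') :=
  Subtype.ext (fromBlocks_add _ _ _ _ _ _ _ _)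

theorem block_smul {n : ℕ} (c : ℂ) (A B : Matrix (Fin n) (Fin n) ℂ) :
    c • block A B = block (c • A) (c • B) :=
  Subtype.ext (fromBlocks_smul _ _ _ _ _)

theorem block_neg {n : ℕ} (A B : Matrix (Fin n) (Fin n) ℂ) :
    -block A B = block (-A) (-B) :=
  Subtype.ext (fromBlocks_neg _ _ _ _)

theorem block_bracket {n : ℕ} (A B A' B' : Matrix (Fin n) (Fin n) ℂ) :
    ⁅block A B, block A' B'⁆ =
      block (A * A' - A' * A + (B * B' + B' * B)) (A * B' - B' * A + (B * A' - A' * B)) :=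
  Subtype.ext (superBracket_fromBlocks A B A' B')

/-- The projection of `Q(n)` to its even part. -/
def queerEven (n : ℕ) : queer n →ₗ[ℂ] queer n :=
  (evenPart n).restrict (by
    rintro _ ⟨A, B, rfl⟩
    exact ⟨A, 0, by simp⟩)

/-- The projection of `Q(n)` to its odd part. -/
def queerOdd (n : ℕ) : queer n →ₗ[ℂ] queer n :=
  (oddPart n).restrict (by
    rintro _ ⟨A, B, rfl⟩
    exact ⟨0, B, by simp⟩)

@[simp] theorem queerEven_block {n : ℕ} (A B : Matrix (Fin n) (Fin n) ℂ) :
    queerEven n (block A B) = block A 0 :=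
  Subtype.ext (evenPart_fromBlocks A B B A)

@[simp] theorem queerOdd_block {n : ℕ} (A B : Matrix (Fin n) (Fin n) ℂ) :
    queerOdd n (block A B) = block 0 B :=
  Subtype.ext (oddPart_fromBlocks A B B A)

theorem even_add_odd {n : ℕ} (x : queer n) : queerEven n x + queerOdd n x = x := by
  obtain ⟨A, B, rfl⟩ := exists_block x
  simp [block_add]

/-- The homogeneous elements of `Q(n)` of parity `0` or `1`. -/
def queerParity (n : ℕ) (p : Fin 2) : Submodule ℂ (queer n) :=
  if p = 0 then LinearMap.range (queerEven n) else LinearMap.range (queerOdd n)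

/-- The standard basis elements `e_{ij}` of the even part. -/
def e {n : ℕ} (i j : Fin n) : queer n :=
  block (Matrix.single i j 1) 0

/-- The standard basis elements `f_{ij}` of the odd part. -/
def f {n : ℕ} (i j : Fin n) : queer n :=
  block 0 (Matrix.single i j 1)

/-- The defining relations of the enveloping algebra:
`x y - (-1)^{|x||y|} y x = [x, y]` for homogeneous `x`, `y`. -/
inductive EnvRel (n : ℕ) : TensorAlgebra ℂ (queer n) → TensorAlgebra ℂ (queer n) → Prop
  | super_comm (p q : Fin 2) (x y : queer n) (hx : x ∈ queerParity n p) (hy : y ∈ queerParity n q) :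
      EnvRel n
        (TensorAlgebra.ι ℂ x * TensorAlgebra.ι ℂ y -
          (-1 : ℂ) ^ ((p : ℕ) * (q : ℕ)) • (TensorAlgebra.ι ℂ y * TensorAlgebra.ι ℂ x))
        (TensorAlgebra.ι ℂ ⁅x, y⁆)

/-- The universal enveloping (super)algebra `U(Q(n))`. -/
def Env (n : ℕ) : Type := RingQuot (EnvRel n)

instance (n : ℕ) : Ring (Env n) := inferInstanceAs (Ring (RingQuot (EnvRel n)))

instance (n : ℕ) : Algebra ℂ (Env n) := inferInstanceAs (Algebra ℂ (RingQuot (EnvRel n)))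

/-- The canonical map `Q(n) → U(Q(n))`. -/
def ι (n : ℕ) : queer n →ₗ[ℂ] Env n :=
  (RingQuot.mkAlgHom ℂ (EnvRel n)).toLinearMap ∘ₗ TensorAlgebra.ι ℂ

/-- The universal property of `U(Q(n))`. -/
def lift {n : ℕ} {A : Type*} [Ring A] [Algebra ℂ A] (g : queer n →ₗ[ℂ] A)
    (hg : ∀ (p q : Fin 2) (x y : queer n), x ∈ queerParity n p → y ∈ queerParity n q →
      g x * g y - (-1 : ℂ) ^ ((p : ℕ) * (q : ℕ)) • (g y * g x) = g ⁅x, y⁆) :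
    Env n →ₐ[ℂ] A :=
  RingQuot.liftAlgHom ℂ ⟨TensorAlgebra.lift ℂ g, by
    rintro _ _ ⟨p, q, x, y, hx, hy⟩
    simpa using hg p q x y hx hy⟩

theorem lift_ι {n : ℕ} {A : Type*} [Ring A] [Algebra ℂ A] (g : queer n →ₗ[ℂ] A)
    (hg : ∀ (p q : Fin 2) (x y : queer n), x ∈ queerParity n p → y ∈ queerParity n q →
      g x * g y - (-1 : ℂ) ^ ((p : ℕ) * (q : ℕ)) • (g y * g x) = g ⁅x, y⁆) (x : queer n) :
    lift g hg (ι n x) = g x := by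
  have h := RingQuot.liftAlgHom_mkAlgHom_apply ℂ (TensorAlgebra.lift ℂ g) (s := EnvRel n) (by
    rintro _ _ ⟨p, q, x, y, hx, hy⟩
    simpa using hg p q x y hx hy) (TensorAlgebra.ι ℂ x)
  rw [TensorAlgebra.lift_ι_apply] at h
  exact h

theorem ι_superComm {n : ℕ} (p q : Fin 2) (x y : queer n)
    (hx : x ∈ queerParity n p) (hy : y ∈ queerParity n q) :
    ι n x * ι n y - (-1 : ℂ) ^ ((p : ℕ) * (q : ℕ)) • (ι n y * ι n x) = ι n ⁅x, y⁆ := by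
  have h := RingQuot.mkAlgHom_rel ℂ (EnvRel.super_comm p q x y hx hy)
  rw [map_sub, map_smul, map_mul, map_mul] at h
  exact h

theorem parity_relation {n : ℕ} (p q : Fin 2) (x y : queer n)
    (hx : x ∈ queerParity n p) (hy : y ∈ queerParity n q) :
    (ι n ∘ₗ (queerEven n - queerOdd n)) x * (ι n ∘ₗ (queerEven n - queerOdd n)) y -
      (-1 : ℂ) ^ ((p : ℕ) * (q : ℕ)) •
        ((ι n ∘ₗ (queerEven n - queerOdd n)) y * (ι n ∘ₗ (queerEven n - queerOdd n)) x) =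
      (ι n ∘ₗ (queerEven n - queerOdd n)) ⁅x, y⁆ := by
  have key : ∀ (r : Fin 2) (z : queer n), z ∈ queerParity n r →
      (queerEven n - queerOdd n) z ∈ queerParity n r := by
    intro r z hz
    fin_cases r
    · obtain ⟨z, rfl⟩ := hz
      obtain ⟨A, B, rfl⟩ := exists_block z
      exact ⟨block A B, by simp [sub_eq_add_neg, block_neg, block_add]⟩
    · obtain ⟨z, rfl⟩ := hz
      obtain ⟨A, B, rfl⟩ := exists_block z
      exact ⟨block A (-B), by simp [sub_eq_add_neg, block_neg, block_add]⟩
  simp only [LinearMap.comp_apply]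
  rw [ι_superComm p q _ _ (key p x hx) (key q y hy)]
  congr 1
  obtain ⟨A, B, rfl⟩ := exists_block x
  obtain ⟨A', B', rfl⟩ := exists_block y
  simp only [LinearMap.sub_apply, queerEven_block, queerOdd_block, block_bracket, sub_eq_add_neg,
    block_neg, block_add]
  congr 1 <;> simp <;> abel

/-- The parity automorphism of `U(Q(n))`: multiplication by `(-1)^{|u|}` on homogeneous `u`. -/
def parity (n : ℕ) : Env n →ₐ[ℂ] Env n :=
  lift (ι n ∘ₗ (queerEven n - queerOdd n)) parity_relation

/-- The adjoint action of `Q(n)` on `U(Q(n))`: the linear extension of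
`ad(a)(u) = a u - (-1)^{|a||u|} u a` from homogeneous `a`, `u`. -/
def adAction {n : ℕ} (a : queer n) (u : Env n) : Env n :=
  ι n a * u - u * ι n (queerEven n a) - parity n u * ι n (queerOdd n a)

/-- `h = diag(n-1, n-3, …, 1-n)` (in both diagonal blocks). -/
def hElt (n : ℕ) : queer n :=
  block (diagonal fun i : Fin n => (n : ℂ) - 1 - 2 * (i : ℕ)) 0

/-- The degree `j` component of the Dynkin grading, `{x | [h, x] = j x}`. -/
def dynkin (n : ℕ) (j : ℤ) : Submodule ℂ (queer n) where
  carrier := {x | ⁅hElt n, x⁆ = (j : ℂ) • x}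
  add_mem' := by
    intro x y (hx : ⁅hElt n, x⁆ = (j : ℂ) • x) (hy : ⁅hElt n, y⁆ = (j : ℂ) • y)
    change ⁅hElt n, x + y⁆ = (j : ℂ) • (x + y)
    have h : ⁅hElt n, x + y⁆ = ⁅hElt n, x⁆ + ⁅hElt n, y⁆ := by
      apply Subtype.ext
      simp only [coe_bracket, superBracket, Submodule.coe_add, map_add, mul_add, add_mul]
      abel
    rw [h, hx, hy, smul_add]
  zero_mem' := by
    apply Subtype.ext
    simp [coe_bracket, superBracket]
  smul_mem' := by
    intro c x (hx : ⁅hElt n, x⁆ = (j : ℂ) • x)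
    change ⁅hElt n, c • x⁆ = (j : ℂ) • (c • x)
    have h : ⁅hElt n, c • x⁆ = c • ⁅hElt n, x⁆ := by
      apply Subtype.ext
      simp only [coe_bracket, superBracket, Submodule.coe_smul, map_smul, mul_smul_comm,
        smul_mul_assoc, smul_add, smul_sub]
    rw [h, hx, smul_comm]

/-- The nilpotent subalgebra `m = ⨁_{j=1}^{n-1} g_{-2j}`. -/
def nilM (n : ℕ) : Submodule ℂ (queer n) :=
  ⨆ j ∈ Finset.Icc 1 (n - 1), dynkin n (-2 * (j : ℤ))

theorem block_mem_dynkin {n : ℕ} (j : ℤ) (A B : Matrix (Fin n) (Fin n) ℂ) :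
    block A B ∈ dynkin n j ↔ block A 0 ∈ dynkin n j ∧ block 0 B ∈ dynkin n j := by
  have key : ∀ A B A' B' : Matrix (Fin n) (Fin n) ℂ,
      block A B = block A' B' ↔ A = A' ∧ B = B' := by
    intro A B A' B'
    constructor
    · intro h
      have h2 := fromBlocks_inj.1 (congrArg Subtype.val h)
      exact ⟨h2.1, h2.2.1⟩
    · rintro ⟨rfl, rfl⟩
      rfl
  change ⁅hElt n, _⁆ = _ ↔ ⁅hElt n, _⁆ = _ ∧ ⁅hElt n, _⁆ = _
  simp [hElt, block_bracket, block_smul, key]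

theorem queerEven_mem_nilM {n : ℕ} {x : queer n} (hx : x ∈ nilM n) : queerEven n x ∈ nilM n := by
  have h : nilM n ≤ (nilM n).comap (queerEven n) := by
    refine iSup₂_le fun j hj y hy => ?_
    obtain ⟨A, B, rfl⟩ := exists_block y
    have h2 := ((block_mem_dynkin _ A B).1 hy).1
    rw [Submodule.mem_comap, queerEven_block]
    exact Submodule.mem_iSup_of_mem j (Submodule.mem_iSup_of_mem hj h2)
  exact h hx

theorem queerOdd_mem_nilM {n : ℕ} {x : queer n} (hx : x ∈ nilM n) : queerOdd n x ∈ nilM n := by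
  have h : nilM n ≤ (nilM n).comap (queerOdd n) := by
    refine iSup₂_le fun j hj y hy => ?_
    obtain ⟨A, B, rfl⟩ := exists_block y
    have h2 := ((block_mem_dynkin _ A B).1 hy).2
    rw [Submodule.mem_comap, queerOdd_block]
    exact Submodule.mem_iSup_of_mem j (Submodule.mem_iSup_of_mem hj h2)
  exact h hx

/-- The odd trace: the trace of the upper right block. -/
def otr {n : ℕ} (X : BlockMat n) : ℂ := X.toBlocks₁₂.trace

/-- `E = ∑_{i=1}^{n-1} f_{i,i+1}`. -/
def EElt (n : ℕ) : queer n :=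
  ∑ i : Fin n, ∑ j : Fin n, if (i : ℕ) + 1 = (j : ℕ) then f i j else 0

/-- The regular nilpotent functional `χ(x) = otr (x E)`. -/
def chi (n : ℕ) : queer n →ₗ[ℂ] ℂ where
  toFun x := otr ((x : BlockMat n) * (EElt n : BlockMat n))
  map_add' x y := by
    simp only [otr, Submodule.coe_add, add_mul]
    rw [← Matrix.trace_add]; rfl
  map_smul' c x := by
    simp only [otr, Submodule.coe_smul, smul_mul_assoc, RingHom.id_apply]
    rw [← Matrix.trace_smul]; rfl

theorem EElt_eq (n : ℕ) : EElt n =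
    block 0 (Matrix.of fun i j : Fin n => if (i : ℕ) + 1 = (j : ℕ) then 1 else 0) := by
  have hS : ∀ (s : Finset (Fin n)) (g : Fin n → Matrix (Fin n) (Fin n) ℂ),
      ∑ i ∈ s, block 0 (g i) = block 0 (∑ i ∈ s, g i) := by
    intro s g
    classical
    induction s using Finset.induction_on with
    | empty => exact Subtype.ext (by simp [block])
    | insert a s ha ih => rw [Finset.sum_insert ha, Finset.sum_insert ha, ih, block_add, add_zero]
  have h0 : (0 : queer n) = block 0 0 := Subtype.ext (by simp [block])
  have h1 : ∀ i j : Fin n, (if (i : ℕ) + 1 = (j : ℕ) then f i j else 0) =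
      block 0 (if (i : ℕ) + 1 = (j : ℕ) then Matrix.single i j (1 : ℂ) else 0) := by
    intro i j
    split_ifs
    · rfl
    · exact h0
  simp only [EElt, h1, hS]
  congr 1
  ext k l
  simp only [Matrix.sum_apply, Matrix.of_apply]
  rw [Finset.sum_eq_single k, Finset.sum_eq_single l]
  · split_ifs <;> simp
  · intro j _ hj
    split_ifs <;> simp [Matrix.single, hj]
  · simp
  · intro i _ hi
    refine Finset.sum_eq_zero fun j _ => ?_
    split_ifs <;> simp [Matrix.single, hi]
  · simp

theorem chi_odd {n : ℕ} (a : queer n) : chi n (queerOdd n a) = 0 := by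
  obtain ⟨A, B, rfl⟩ := exists_block a
  rw [queerOdd_block]
  change otr ((block 0 B : BlockMat n) * (EElt n : BlockMat n)) = 0
  rw [EElt_eq]
  simp [block, otr, fromBlocks_multiply]

/-- The left ideal `I_χ` of `U(Q(n))` generated by `a - χ(a)`, `a ∈ m`. -/
def leftIdeal (n : ℕ) : Submodule (Env n) (Env n) :=
  Submodule.span (Env n) {u | ∃ a ∈ nilM n, u = ι n a - algebraMap ℂ (Env n) (chi n a)}

/-- The generalized Whittaker module `Q_χ = U(Q(n)) / I_χ`. -/
abbrev WhittakerModule (n : ℕ) := Env n ⧸ leftIdeal n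

/-- The natural projection `π : U(Q(n)) → U(Q(n)) / I_χ`. -/
def proj (n : ℕ) : Env n →ₗ[Env n] WhittakerModule n := (leftIdeal n).mkQ

/-- The finite `W`-algebra `W_χ = End_{U(Q(n))}(Q_χ)^{op}`. -/
abbrev FiniteW (n : ℕ) := (Module.End (Env n) (WhittakerModule n))ᵐᵒᵖ

/-- The Whittaker vectors `{v ∈ Q_χ | a v = χ(a) v for all a ∈ m}`. -/
def whittakerVectors (n : ℕ) : Submodule ℂ (WhittakerModule n) where
  carrier := {v | ∀ a ∈ nilM n, ι n a • v = chi n a • v}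
  add_mem' := by
    intro v w hv hw a ha
    rw [smul_add, smul_add, hv a ha, hw a ha]
  zero_mem' := by
    intro a _
    rw [smul_zero, smul_zero]
  smul_mem' := by
    intro c v hv a ha
    rw [smul_comm, hv a ha, smul_comm]

theorem proj_gen {n : ℕ} (a : queer n) (ha : a ∈ nilM n) :
    ι n a • proj n 1 = chi n a • proj n 1 := by
  have h : proj n (ι n a - algebraMap ℂ (Env n) (chi n a)) = 0 := by
    rw [proj, Submodule.mkQ_apply, Submodule.Quotient.mk_eq_zero]
    exact Submodule.subset_span ⟨a, ha, rfl⟩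
  rw [map_sub, sub_eq_zero] at h
  rw [← map_smul, smul_eq_mul, mul_one, h, Algebra.algebraMap_eq_smul_one]
  rfl

/-- The identification of `W_χ` with the space of Whittaker vectors, `φ ↦ φ(π(1))`. -/
def wEquiv (n : ℕ) : FiniteW n ≃ₗ[ℂ] whittakerVectors n where
  toFun w := ⟨w.unop (proj n 1), by
    intro a ha
    rw [← map_smul, proj_gen a ha]
    exact LinearMap.map_smul_of_tower w.unop (chi n a) (proj n 1)⟩
  map_add' _ _ := rfl
  map_smul' _ _ := rfl
  invFun v := MulOpposite.op <| (leftIdeal n).liftQ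
    (LinearMap.toSpanSingleton (Env n) (WhittakerModule n) (v : WhittakerModule n)) (by
      refine Submodule.span_le.2 ?_
      rintro _ ⟨a, ha, rfl⟩
      have := v.2 a ha
      simp [sub_smul, this])
  left_inv w := by
    apply MulOpposite.unop_injective
    refine LinearMap.ext fun q => ?_
    obtain ⟨u, rfl⟩ := (leftIdeal n).mkQ_surjective q
    have h : (leftIdeal n).mkQ u = u • proj n 1 := by
      rw [← map_smul, smul_eq_mul, mul_one]; rfl
    conv_rhs => rw [h, map_smul]
    rfl
  right_inv v := by
    apply Subtype.ext
    exact one_smul (Env n) (v : WhittakerModule n)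

/-- The product of `W_χ` in terms of Whittaker vectors: `π(y₁) π(y₂) = π(y₁ y₂)`. -/
theorem wEquiv_mul {n : ℕ} (w₁ w₂ : FiniteW n) (y₁ y₂ : Env n)
    (h₁ : (wEquiv n w₁ : WhittakerModule n) = proj n y₁)
    (h₂ : (wEquiv n w₂ : WhittakerModule n) = proj n y₂) :
    (wEquiv n (w₁ * w₂) : WhittakerModule n) = proj n (y₁ * y₂) := by
  change w₁.unop (proj n 1) = _ at h₁
  change w₂.unop (proj n 1) = _ at h₂
  change w₂.unop (w₁.unop (proj n 1)) = _
  have h : ∀ y z : Env n, proj n (y * z) = y • proj n z := fun y z => map_smul (proj n) y z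
  have h3 := h y₁ 1
  rw [mul_one] at h3
  rw [h₁, h3, map_smul, h₂, h]

theorem queerEven_odd {n : ℕ} (a : queer n) :
    queerEven n (queerEven n a) = queerEven n a ∧ queerOdd n (queerOdd n a) = queerOdd n a ∧
      queerEven n (queerOdd n a) = 0 ∧ queerOdd n (queerEven n a) = 0 := by
  obtain ⟨A, B, rfl⟩ := exists_block a
  have h : block (0 : Matrix (Fin n) (Fin n) ℂ) 0 = 0 := Subtype.ext (by simp [block])
  simp [h]

theorem adInvariant_comm {n : ℕ} {u : Env n} (hu : ∀ a ∈ nilM n, adAction a u = 0) {a : queer n}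
    (ha : a ∈ nilM n) :
    ι n a * u = u * ι n (queerEven n a) + parity n u * ι n (queerOdd n a) := by
  have h := hu a ha
  rwa [adAction, sub_sub, sub_eq_zero] at h

theorem adInvariant_even {n : ℕ} {u : Env n} (hu : ∀ a ∈ nilM n, adAction a u = 0) {a : queer n}
    (ha : a ∈ nilM n) : ι n (queerEven n a) * u = u * ι n (queerEven n a) := by
  have h := adInvariant_comm hu (queerEven_mem_nilM ha)
  obtain ⟨h1, h2, h3, h4⟩ := queerEven_odd a
  simpa [h1, h4] using h

theorem adInvariant_odd {n : ℕ} {u : Env n} (hu : ∀ a ∈ nilM n, adAction a u = 0) {a : queer n}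
    (ha : a ∈ nilM n) : ι n (queerOdd n a) * u = parity n u * ι n (queerOdd n a) := by
  have h := adInvariant_comm hu (queerOdd_mem_nilM ha)
  obtain ⟨h1, h2, h3, h4⟩ := queerEven_odd a
  simpa [h2, h3] using h

/-- The subalgebra `U(Q(n))^{ad m}` of `ad m`-invariants. -/
def adInvariants (n : ℕ) : Subalgebra ℂ (Env n) where
  carrier := {u | ∀ a ∈ nilM n, adAction a u = 0}
  mul_mem' := by
    intro u v hu hv a ha
    have hu' := adInvariant_comm hu ha
    have h0 := adInvariant_even hv ha
    have h1 := adInvariant_odd hv ha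
    simp only [adAction, map_mul]
    rw [← mul_assoc, hu', add_mul, mul_assoc, h0, mul_assoc, h1]
    simp only [mul_assoc]
    abel
  add_mem' := by
    intro u v hu hv a ha
    have hu' := hu a ha
    have hv' := hv a ha
    simp only [adAction, map_add, mul_add, add_mul] at *
    rw [← add_zero (0 : Env n)]
    nth_rewrite 1 [← hu']
    rw [← hv']
    abel
  algebraMap_mem' := by
    intro c a _
    simp only [adAction, AlgHom.commutes]
    rw [sub_sub, ← mul_add, ← map_add, even_add_odd, Algebra.commutes, sub_self]

/-- Right multiplication by an `ad m`-invariant on `Q_χ`. -/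
def rightMul {n : ℕ} (u : adInvariants n) : Module.End (Env n) (WhittakerModule n) :=
  (leftIdeal n).mapQ (leftIdeal n) (LinearMap.toSpanSingleton (Env n) (Env n) (u : Env n)) (by
    refine Submodule.span_le.2 ?_
    rintro _ ⟨a, ha, rfl⟩
    have h : (ι n a - algebraMap ℂ (Env n) (chi n a)) * (u : Env n) =
        (u : Env n) * (ι n (queerEven n a) - algebraMap ℂ (Env n) (chi n (queerEven n a))) +
        parity n u * (ι n (queerOdd n a) - algebraMap ℂ (Env n) (chi n (queerOdd n a))) := by
      have h0 : chi n (queerEven n a) = chi n a := by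
        conv_rhs => rw [← even_add_odd a, map_add, chi_odd, add_zero]
      rw [chi_odd, h0, map_zero, sub_zero, sub_mul, adInvariant_comm u.2 ha, mul_sub,
        Algebra.commutes]
      abel
    change (ι n a - algebraMap ℂ (Env n) (chi n a)) * (u : Env n) ∈ leftIdeal n
    rw [h]
    exact add_mem
      ((leftIdeal n).smul_mem _ (Submodule.subset_span ⟨_, queerEven_mem_nilM ha, rfl⟩))
      ((leftIdeal n).smul_mem _ (Submodule.subset_span ⟨_, queerOdd_mem_nilM ha, rfl⟩)))

theorem rightMul_proj {n : ℕ} (u : adInvariants n) (y : Env n) :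
    rightMul u (proj n y) = proj n (y * u) := rfl

theorem proj_surjective (n : ℕ) : Function.Surjective (proj n) := (leftIdeal n).mkQ_surjective

/-- The natural homomorphism `U(Q(n))^{ad m} → W_χ`, sending `u` to the class `π(u)`, that is, to
right multiplication by `u` on `Q_χ`. -/
def invariantsToW (n : ℕ) : adInvariants n →ₐ[ℂ] FiniteW n :=
  AlgHom.ofLinearMap
    { toFun := fun u => MulOpposite.op (rightMul u)
      map_add' := by
        intro u v
        apply MulOpposite.unop_injective
        refine LinearMap.ext fun q => ?_
        obtain ⟨y, rfl⟩ := proj_surjective n q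
        change proj n (y * (u + v)) = proj n (y * u) + proj n (y * v)
        rw [mul_add, map_add]
      map_smul' := by
        intro c u
        apply MulOpposite.unop_injective
        refine LinearMap.ext fun q => ?_
        obtain ⟨y, rfl⟩ := proj_surjective n q
        change proj n (y * (c • (u : Env n))) = c • proj n (y * u)
        rw [mul_smul_comm]
        rfl }
    (by
      apply MulOpposite.unop_injective
      refine LinearMap.ext fun q => ?_
      obtain ⟨y, rfl⟩ := proj_surjective n q
      change proj n (y * 1) = proj n y
      rw [mul_one])
    (by
      intro u v
      apply MulOpposite.unop_injective
      refine LinearMap.ext fun q => ?_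
      obtain ⟨y, rfl⟩ := proj_surjective n q
      change proj n (y * (u * v)) = proj n (y * u * v)
      rw [mul_assoc])

theorem wEquiv_invariantsToW {n : ℕ} (u : adInvariants n) :
    (wEquiv n (invariantsToW n u) : WhittakerModule n) = proj n u := by
  change proj n (1 * (u : Env n)) = proj n u
  rw [one_mul]

mutual

/-- The elements `e_{ij}^{(m)}` of `U(Q(n))`; the recursion is started at `m = 0` with
`e_{ij}^{(0)} = δ_{ij}`, `f_{ij}^{(0)} = 0`, which gives `e_{ij}^{(1)} = e_{ij}` and
`f_{ij}^{(1)} = f_{ij}`. -/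
def eElt {n : ℕ} : ℕ → Fin n → Fin n → Env n
  | 0, i, j => if i = j then 1 else 0
  | m + 1, i, j => ∑ k, ι n (e i k) * eElt m k j +
      (-1 : ℂ) ^ (m + 2) • ∑ k, ι n (f i k) * fElt m k j

/-- The elements `f_{ij}^{(m)}` of `U(Q(n))`. -/
def fElt {n : ℕ} : ℕ → Fin n → Fin n → Env n
  | 0, _, _ => 0
  | m + 1, i, j => ∑ k, ι n (e i k) * fElt m k j +
      (-1 : ℂ) ^ (m + 2) • ∑ k, ι n (f i k) * eElt m k j

end

end QueerW

end

/-!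
Call `e_{n,1}^{(m)}` and `f_{n,1}^{(m)}` with `n ≤ m ≤ 2n - 1` the corner elements. Filter `Q_χ`
by the Kazhdan degree, in which `e_{ij}` and `f_{ij}` have degree `j - i + 1`. Up to decomposable
elements and terms of smaller degree, the corner elements with `m = 2n - i` are nonzero multiples
of the basis elements in row `i` of the last column. Hence `Q_χ` is spanned by words in letters
that are the basis elements on or above the diagonal and left of the last column, together with
the corner elements, and the words of degree at most `d` span the vectors of degree at most `d`.

Let `v` be a Whittaker vector. For a letter `y` at `(i, j)` with `j < n`, let `θ = a - χ(a)` where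
`a ∈ m` is the basis element of the same parity at `(j + 1, i)`. On leading terms `θ` is a
derivation that kills every corner element and every other letter in column at most `j`, and maps
`y` to `1`. So once the letters in later columns have been removed, `yθ` has eigenvalue `0` on
leading terms of words without `y`, and only positive integer eigenvalues on the others. Since
`θ v = 0`, the leading term of `v` does not involve `y`. Eliminating the columns from right to left,
the leading term of `v` becomes that of a polynomial in the corner elements. The corner elements
are `ad m`-invariant, so this polynomial gives a Whittaker vector too, and induction on the degree
writes `v` as the image of a polynomial in the corner elements.
-/

noncomputable section

namespace QueerW

section Superalgebra

/-- The Koszul sign `(-1)^{pm}`. The second argument is a natural number, so that it can be a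
parity as well as the exponent `m` of `e_{ij}^{(m)}`. -/
def koszulSign (p : Fin 2) (m : ℕ) : ℂ := (-1) ^ ((p : ℕ) * m)

theorem koszulSign_zero_left (m : ℕ) : koszulSign 0 m = 1 := by simp [koszulSign]

theorem koszulSign_one_left (m : ℕ) : koszulSign 1 m = (-1) ^ m := by simp [koszulSign]

theorem koszulSign_ne_zero (p : Fin 2) (m : ℕ) : koszulSign p m ≠ 0 :=
  pow_ne_zero _ (neg_ne_zero.2 one_ne_zero)

theorem koszulSign_add_right (p q r : Fin 2) :
    koszulSign p (q + r : Fin 2) = koszulSign p q * koszulSign p r := by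
  fin_cases p <;> fin_cases q <;> fin_cases r <;> simp [koszulSign, Fin.add_def]

theorem koszulSign_mul_self (p : Fin 2) (m : ℕ) : koszulSign p m * koszulSign p m = 1 := by
  rw [koszulSign, ← mul_pow, neg_one_mul, neg_neg, one_pow]

variable {A : Type*} [Ring A] [Algebra ℂ A]

/-- The supercommutator `b ↦ a b - (-1)^{pq} b a` with an element `a` of parity `p`, on elements `b`
of parity `q`. The parities are parameters because `A` carries no grading here. -/
def superComm (p q : Fin 2) (a : A) : A →ₗ[ℂ] A :=
  LinearMap.mulLeft ℂ a - koszulSign p q • LinearMap.mulRight ℂ a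

theorem superComm_apply (p q : Fin 2) (a b : A) :
    superComm p q a b = a * b - koszulSign p q • (b * a) := rfl

theorem superComm_mul (p q r : Fin 2) (a b c : A) :
    superComm p (q + r) a (b * c) =
      superComm p q a b * c + koszulSign p q • (b * superComm p r a c) := by
  simp only [superComm_apply, koszulSign_add_right, sub_mul, mul_sub, smul_sub, smul_mul_assoc,
    mul_smul_comm, smul_smul, mul_assoc]
  abel

end Superalgebra

section Generators

variable {n : ℕ}

/-- The basis element `e_{ij}` (for `p = 0`) or `f_{ij}` (for `p = 1`) of `Q(n)`. -/
def gen (p : Fin 2) (i j : Fin n) : queer n := if p = 0 then e i j else f i j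

/-- The element `e_{ij}^{(m)}` (for `p = 0`) or `f_{ij}^{(m)}` (for `p = 1`) of `U(Q(n))`. -/
def power (m : ℕ) (p : Fin 2) (i j : Fin n) : Env n :=
  if p = 0 then eElt m i j else fElt m i j

theorem block_zero_zero : block (0 : Matrix (Fin n) (Fin n) ℂ) 0 = 0 :=
  Subtype.ext (by simp [block])

theorem queerEven_gen (p : Fin 2) (i j : Fin n) :
    queerEven n (gen p i j) = if p = 0 then gen p i j else 0 := by
  fin_cases p <;> simp [gen, e, f, block_zero_zero]

theorem queerOdd_gen (p : Fin 2) (i j : Fin n) :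
    queerOdd n (gen p i j) = if p = 0 then 0 else gen p i j := by
  fin_cases p <;> simp [gen, e, f, block_zero_zero]

theorem gen_mem_queerParity (p : Fin 2) (i j : Fin n) : gen p i j ∈ queerParity n p := by
  fin_cases p
  · exact ⟨gen 0 i j, by simp [queerEven_gen]⟩
  · exact ⟨gen 1 i j, by simp [queerOdd_gen]⟩

theorem gen_bracket (p q : Fin 2) (i j k l : Fin n) :
    ⁅gen p i j, gen q k l⁆ = (if j = k then gen (p + q) i l else 0) -
      koszulSign p q • (if i = l then gen (p + q) k j else 0) := by
  have single_mul_single : ∀ a b c d : Fin n, Matrix.single a b (1 : ℂ) * Matrix.single c d 1 =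
      if b = c then Matrix.single a d 1 else 0 := by
    intro a b c d
    split_ifs with h
    · subst h; simp
    · rw [Matrix.single_mul_single_of_ne _ _ _ _ h]
  have one_add_one : (1 + 1 : Fin 2) = 0 := rfl
  fin_cases p <;> fin_cases q <;>
    simp [gen, e, f, block_bracket, single_mul_single, ← block_zero_zero, one_add_one, koszulSign,
      eq_comm (a := l)] <;> split_ifs <;>
    simp [block_add, sub_eq_add_neg, block_neg, block_smul, block_zero_zero]

theorem superComm_ι {p q : Fin 2} {x y : queer n} (hx : x ∈ queerParity n p)
    (hy : y ∈ queerParity n q) : superComm p q (ι n x) (ι n y) = ι n ⁅x, y⁆ :=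
  ι_superComm p q x y hx hy

theorem superComm_gen_gen (p q : Fin 2) (i j k l : Fin n) :
    superComm p q (ι n (gen p i j)) (ι n (gen q k l)) =
      (if j = k then ι n (gen (p + q) i l) else 0) -
        koszulSign p q • (if i = l then ι n (gen (p + q) k j) else 0) := by
  rw [superComm_ι (gen_mem_queerParity p i j) (gen_mem_queerParity q k l), gen_bracket, map_sub,
    map_smul, apply_ite (ι n), apply_ite (ι n), map_zero]

theorem power_zero (p : Fin 2) (i j : Fin n) :
    power 0 p i j = if p = 0 ∧ i = j then 1 else 0 := by
  fin_cases p <;> simp [power, eElt, fElt]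

theorem power_succ (m : ℕ) (p : Fin 2) (i j : Fin n) :
    power (m + 1) p i j =
      ∑ q, koszulSign q m • ∑ k, ι n (gen q i k) * power m (p + q) k j := by
  have one_add_one : (1 + 1 : Fin 2) = 0 := rfl
  fin_cases p <;> simp [power, eElt, fElt, gen, one_add_one, pow_add, koszulSign]

/-- The sign of the first term, which is `1` for `m = 1`, comes from the alternating signs in the
recursion for `e_{ij}^{(m)}` and `f_{ij}^{(m)}`. -/
theorem superComm_gen_power (m : ℕ) (p q : Fin 2) (i j k l : Fin n) :
    superComm p q (ι n (gen p i j)) (power m q k l) =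
      koszulSign p (m + 1) • (if j = k then power m (p + q) i l else 0) -
        koszulSign p q • (if i = l then power m (p + q) k j else 0) := by
  have one_add_one : (1 + 1 : Fin 2) = 0 := rfl
  induction m generalizing q k with
  | zero =>
    fin_cases p <;> fin_cases q <;>
      simp only [superComm_apply, power_zero, koszulSign, eq_comm] <;>
      split_ifs <;> simp_all
  | succ m ih =>
    have summand (r : Fin 2) :
        superComm p q (ι n (gen p i j)) (∑ a, ι n (gen r k a) * power m (q + r) a l) =
          (if j = k then ∑ a, ι n (gen (p + r) i a) * power m (q + r) a l else 0) -
            koszulSign p r • (ι n (gen (p + r) k j) * power m (q + r) i l) +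
            (koszulSign p r * koszulSign p (m + 1)) •
              (ι n (gen r k j) * power m (p + (q + r)) i l) -
            koszulSign p q •
              (if i = l then ∑ a, ι n (gen r k a) * power m (p + (q + r)) a j else 0) := by
      have leibniz (a : Fin n) :
          superComm p q (ι n (gen p i j)) (ι n (gen r k a) * power m (q + r) a l) =
            superComm p r (ι n (gen p i j)) (ι n (gen r k a)) * power m (q + r) a l +
              koszulSign p r •
                (ι n (gen r k a) *
                  superComm p (q + r) (ι n (gen p i j)) (power m (q + r) a l)) := by
        rw [← superComm_mul]
        congr 2
        fin_cases q <;> fin_cases r <;> rfl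
      have sign_eq : koszulSign p r * koszulSign p (q + r : Fin 2) = koszulSign p q := by
        rw [koszulSign_add_right, mul_left_comm, koszulSign_mul_self, mul_one]
      simp only [map_sum, leibniz, superComm_gen_gen, ih, sub_mul, mul_sub, smul_sub,
        smul_mul_assoc, mul_smul_comm, ite_mul, mul_ite, zero_mul, mul_zero, smul_smul, sign_eq,
        Finset.sum_add_distrib, Finset.sum_sub_distrib, ← Finset.smul_sum, Finset.sum_ite_eq,
        Finset.sum_ite_irrel, Finset.sum_const_zero, Finset.mem_univ, if_true]
      abel
    have sign_sq : ∀ x : Env n, (-1 : ℂ) ^ m • (-1 : ℂ) ^ m • x = x := fun x => by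
      rw [smul_smul, ← mul_pow, neg_one_mul, neg_neg, one_pow, one_smul]
    rw [power_succ, map_sum]
    simp only [map_smul, summand, power_succ, Fin.sum_univ_two]
    fin_cases p <;> fin_cases q <;> simp [one_add_one, pow_add, koszulSign] <;> split_ifs <;>
      simp [smul_add, sign_sq, sub_eq_add_neg, smul_neg] <;> abel

end Generators

section Nilradical

variable {n : ℕ}

theorem block_inj {A B A' B' : Matrix (Fin n) (Fin n) ℂ} :
    block A B = block A' B' ↔ A = A' ∧ B = B' := by
  refine ⟨fun h => ?_, by rintro ⟨rfl, rfl⟩; rfl⟩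
  obtain ⟨hA, hB, -⟩ := Matrix.fromBlocks_inj.1 (congrArg Subtype.val h)
  exact ⟨hA, hB⟩

theorem block_mem_dynkin_iff {A B : Matrix (Fin n) (Fin n) ℂ} {k : ℤ} :
    block A B ∈ dynkin n k ↔
      ∀ i j : Fin n, 2 * ((j : ℤ) - i) ≠ k → A i j = 0 ∧ B i j = 0 := by
  have eigenvalue (i j : Fin n) (c : ℂ) :
      ((n : ℂ) - 1 - 2 * (i : ℕ)) * c - c * ((n : ℂ) - 1 - 2 * (j : ℕ)) = k * c ↔
        (2 * ((j : ℤ) - i) ≠ k → c = 0) := by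
    have factor : ((n : ℂ) - 1 - 2 * (i : ℕ)) * c - c * ((n : ℂ) - 1 - 2 * (j : ℕ)) - k * c =
        ((2 * ((j : ℤ) - i) - k : ℤ) : ℂ) * c := by
      push_cast
      ring
    rw [← sub_eq_zero, factor, mul_eq_zero, Int.cast_eq_zero, sub_eq_zero, or_iff_not_imp_left]
  change ⁅hElt n, block A B⁆ = (k : ℂ) • block A B ↔ _
  simp only [hElt, block_bracket, block_smul, block_inj, zero_mul, mul_zero, add_zero, sub_zero,
    ← Matrix.ext_iff, Matrix.sub_apply, Matrix.diagonal_mul, Matrix.mul_diagonal,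
    Matrix.smul_apply, smul_eq_mul, eigenvalue]
  exact ⟨fun h i j hij => ⟨h.1 i j hij, h.2 i j hij⟩,
    fun h => ⟨fun i j hij => (h i j hij).1, fun i j hij => (h i j hij).2⟩⟩

theorem block_eq_sum (A B : Matrix (Fin n) (Fin n) ℂ) :
    block A B = ∑ i, ∑ j, (A i j • gen 0 i j + B i j • gen 1 i j) := by
  apply Subtype.ext
  simp only [gen, e, f, block, Submodule.coe_sum, Submodule.coe_add, Submodule.coe_smul]
  ext (a | a) (b | b) <;>
    simp [Matrix.sum_apply, Matrix.single_apply, ite_and, Finset.sum_ite_eq']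

theorem gen_mem_dynkin (p : Fin 2) (i j : Fin n) : gen p i j ∈ dynkin n (2 * ((j : ℤ) - i)) := by
  fin_cases p <;>
    simp only [gen, e, f, Fin.zero_eta, Fin.mk_one, one_ne_zero, if_true, if_false,
      block_mem_dynkin_iff, Matrix.single_apply, Matrix.zero_apply] <;>
    intro a b hab <;> simp <;> grind

theorem nilM_eq_span (n : ℕ) :
    nilM n = Submodule.span ℂ {x | ∃ (p : Fin 2) (i j : Fin n), j < i ∧ gen p i j = x} := by
  refine le_antisymm (iSup₂_le fun s hs x hx => ?_) (Submodule.span_le.2 ?_)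
  · obtain ⟨A, B, rfl⟩ := exists_block x
    rw [block_eq_sum]
    refine Submodule.sum_mem _ fun i _ => Submodule.sum_mem _ fun j _ => ?_
    rcases lt_or_ge j i with hji | hij
    · exact add_mem (Submodule.smul_mem _ _ (Submodule.subset_span ⟨0, i, j, hji, rfl⟩))
        (Submodule.smul_mem _ _ (Submodule.subset_span ⟨1, i, j, hji, rfl⟩))
    · have hs := (Finset.mem_Icc.1 hs).1
      obtain ⟨hA, hB⟩ := block_mem_dynkin_iff.1 hx i j (by omega)
      simp only [hA, hB, zero_smul, add_zero, zero_mem]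
  · rintro _ ⟨p, i, j, hji, rfl⟩
    refine Submodule.mem_iSup_of_mem ((i : ℕ) - j) (Submodule.mem_iSup_of_mem
      (Finset.mem_Icc.2 (by omega)) ?_)
    convert gen_mem_dynkin p i j using 2
    omega

theorem gen_mem_nilM (p : Fin 2) {i j : Fin n} (hji : j < i) : gen p i j ∈ nilM n := by
  rw [nilM_eq_span]
  exact Submodule.subset_span ⟨p, i, j, hji, rfl⟩

theorem chi_gen (p : Fin 2) (i j : Fin n) :
    chi n (gen p i j) = if p = 0 ∧ (i : ℕ) = j + 1 then 1 else 0 := by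
  change otr ((gen p i j : BlockMat n) * (EElt n : BlockMat n)) = _
  rw [EElt_eq]
  fin_cases p
  · simp [gen, e, block, otr, Matrix.fromBlocks_multiply, Matrix.trace_single_mul, eq_comm]
  · simp [gen, f, block, otr, Matrix.fromBlocks_multiply]

end Nilradical

section Invariants

variable {n : ℕ}

theorem parity_gen (p : Fin 2) (i j : Fin n) :
    parity n (ι n (gen p i j)) = koszulSign p 1 • ι n (gen p i j) := by
  refine (lift_ι _ _ _).trans ?_
  fin_cases p <;> simp [queerEven_gen, queerOdd_gen, koszulSign]

theorem parity_power (m : ℕ) (p : Fin 2) (i j : Fin n) :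
    parity n (power m p i j) = koszulSign p 1 • power m p i j := by
  have one_add_one : (1 + 1 : Fin 2) = 0 := rfl
  induction m generalizing p i with
  | zero => fin_cases p <;> simp [power_zero, apply_ite (parity n), koszulSign]
  | succ m ih =>
    simp only [power_succ, Fin.sum_univ_two, map_add, map_smul, map_sum, map_mul, parity_gen, ih]
    fin_cases p <;> simp [one_add_one, koszulSign]

theorem adAction_gen {q : Fin 2} {u : Env n} (hu : parity n u = koszulSign q 1 • u) (p : Fin 2)
    (i j : Fin n) : adAction (gen p i j) u = superComm p q (ι n (gen p i j)) u := by
  rw [adAction, queerEven_gen, queerOdd_gen, hu, superComm_apply]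
  fin_cases p <;> simp [koszulSign]

theorem mem_adInvariants_iff_gen {u : Env n} :
    u ∈ adInvariants n ↔ ∀ (p : Fin 2) (i j : Fin n), j < i → adAction (gen p i j) u = 0 := by
  refine ⟨fun hu p i j hji => hu _ (gen_mem_nilM p hji), fun hu a ha => ?_⟩
  rw [nilM_eq_span] at ha
  induction ha using Submodule.span_induction with
  | zero => simp [adAction]
  | add x y _ _ hx hy =>
    calc adAction (x + y) u = adAction x u + adAction y u := by
          simp only [adAction, map_add, mul_add, add_mul]
          abel
      _ = 0 := by rw [hx, hy, add_zero]
  | smul c x _ hx =>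
    calc adAction (c • x) u = c • adAction x u := by
          simp only [adAction, map_smul, mul_smul_comm, smul_mul_assoc, smul_sub]
      _ = 0 := by rw [hx, smul_zero]
  | mem x hx =>
    obtain ⟨p, i, j, hji, rfl⟩ := hx
    exact hu p i j hji

theorem power_mem_adInvariants (m : ℕ) (p : Fin 2) {k l : Fin n} (hk : (k : ℕ) + 1 = n)
    (hl : (l : ℕ) = 0) : power m p k l ∈ adInvariants n := by
  refine mem_adInvariants_iff_gen.2 fun q i j hji => ?_
  have hjk : j ≠ k := fun h => by subst h; omega
  have hil : i ≠ l := fun h => by subst h; omega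
  rw [adAction_gen (parity_power m p k l), superComm_gen_power, if_neg hjk, if_neg hil, smul_zero,
    smul_zero, sub_zero]

end Invariants

section Words

variable {σ A M : Type*} (R : Type*) [CommSemiring R] [Semiring A] [AddCommMonoid M] [Module R M]
  [Module A M]

/-- The span of the vectors `z x₁ ⋯ z xᵣ • v₀` with letters `x₁, …, xᵣ` in `S` whose degrees add up
to at most `d`. -/
def wordSpan (z : σ → A) (deg : σ → ℤ) (v₀ : M) (S : Set σ) (d : ℤ) : Submodule R M :=
  Submodule.span R {v | ∃ w : List σ, (∀ x ∈ w, x ∈ S) ∧ (w.map deg).sum ≤ d ∧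
    (w.map z).prod • v₀ = v}

variable {R} {z : σ → A} {deg : σ → ℤ} {v₀ : M} {S T : Set σ} {d d' : ℤ}

theorem wordSpan_mono (hST : S ⊆ T) (hd : d ≤ d') :
    wordSpan R z deg v₀ S d ≤ wordSpan R z deg v₀ T d' := by
  refine Submodule.span_mono ?_
  rintro v ⟨w, hw, hdeg, rfl⟩
  exact ⟨w, fun x hx => hST (hw x hx), hdeg.trans hd, rfl⟩

theorem self_mem_wordSpan (hd : 0 ≤ d) : v₀ ∈ wordSpan R z deg v₀ S d :=
  Submodule.subset_span ⟨[], by simp, by simpa using hd, by simp⟩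

theorem wordSpan_eq_bot_of_neg (hdeg : ∀ x ∈ S, 0 ≤ deg x) (hd : d < 0) :
    wordSpan R z deg v₀ S d = ⊥ := by
  rw [wordSpan, Submodule.span_eq_bot]
  rintro v ⟨w, hw, hsum, -⟩
  have nonneg : 0 ≤ (w.map deg).sum :=
    List.sum_nonneg fun _ ha => by
      obtain ⟨x, hx, rfl⟩ := List.mem_map.1 ha
      exact hdeg x (hw x hx)
  omega

theorem wordSpan_le (hdeg : ∀ x ∈ S, 0 < deg x) {N : ℤ → Submodule R M}
    (one : ∀ d, 0 ≤ d → v₀ ∈ N d)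
    (smul : ∀ d, (∀ d' < d, wordSpan R z deg v₀ S d' ≤ N d') → ∀ x ∈ S,
      ∀ v ∈ wordSpan R z deg v₀ S (d - deg x), z x • v ∈ N d) (d : ℤ) :
    wordSpan R z deg v₀ S d ≤ N d := by
  induction d using Int.strongRec (m := 0) with
  | lt d hd =>
    rw [wordSpan_eq_bot_of_neg (fun x hx => (hdeg x hx).le) hd]
    exact bot_le
  | ge d _ ih =>
    refine Submodule.span_le.2 ?_
    rintro _ ⟨_ | ⟨x, w⟩, hw, hsum, rfl⟩
    · simpa using one d hsum
    · obtain ⟨hx, hw⟩ := List.forall_mem_cons.1 hw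
      rw [List.map_cons, List.sum_cons] at hsum
      rw [List.map_cons, List.prod_cons, mul_smul]
      exact smul d ih x hx _ (Submodule.subset_span ⟨w, hw, by omega, rfl⟩)

variable [Algebra R A] [IsScalarTower R A M]

theorem smul_mem_wordSpan {x : σ} (hx : x ∈ S) {v : M}
    (hv : v ∈ wordSpan R z deg v₀ S (d - deg x)) : z x • v ∈ wordSpan R z deg v₀ S d := by
  have prepend :
      wordSpan R z deg v₀ S (d - deg x) ≤
        (wordSpan R z deg v₀ S d).comap (Algebra.lsmul R R M (z x)) := by
    refine Submodule.span_le.2 ?_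
    rintro _ ⟨w, hw, hdeg, rfl⟩
    refine Submodule.subset_span ⟨x :: w, List.forall_mem_cons.2 ⟨hx, hw⟩, ?_, ?_⟩
    · rw [List.map_cons, List.sum_cons]
      omega
    · rw [List.map_cons, List.prod_cons, mul_smul, Algebra.lsmul_coe]
  exact prepend hv

/-- The elements of `A` that raise the filtration degree on `M` by at most `s`. -/
def operatorFiltration (A : Type*) [Semiring A] [Algebra R A] [Module A M] [IsScalarTower R A M]
    (F : ℤ → Submodule R M) (s : ℤ) : Submodule R A where
  carrier := {u | ∀ d, ∀ v ∈ F d, u • v ∈ F (d + s)}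
  zero_mem' d v _ := by rw [zero_smul]; exact zero_mem _
  add_mem' hu hv d w hw := by rw [add_smul]; exact add_mem (hu d w hw) (hv d w hw)
  smul_mem' c u hu d w hw := by rw [smul_assoc]; exact Submodule.smul_mem _ c (hu d w hw)

variable {F : ℤ → Submodule R M} {s t : ℤ} {u v : A}

theorem operatorFiltration_mono (hF : Monotone F) (hst : s ≤ t) :
    operatorFiltration A F s ≤ operatorFiltration A F t :=
  fun _ hu d w hw => hF (by omega) (hu d w hw)

theorem mul_mem_operatorFiltration (hu : u ∈ operatorFiltration A F s)
    (hv : v ∈ operatorFiltration A F t) : u * v ∈ operatorFiltration A F (s + t) := by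
  intro d w hw
  rw [mul_smul, add_comm s, ← add_assoc]
  exact hu _ _ (hv _ _ hw)

theorem algebraMap_mem_operatorFiltration (c : R) :
    algebraMap R A c ∈ operatorFiltration A F 0 := by
  intro d w hw
  rw [algebraMap_smul, add_zero]
  exact Submodule.smul_mem _ c hw

end Words

section Kazhdan

variable {n : ℕ}

/-- The Kazhdan degree `j - i + 1` of `e_{ij}` and `f_{ij}`, both indexed by a triple `(p, i, j)`
whose first entry is the parity. -/
def degree (x : Fin 2 × Fin n × Fin n) : ℤ := (x.2.2 : ℤ) - x.2.1 + 1

/-- The indices of the basis elements of `Q(n)` that lie on or above the diagonal, so that they span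
a complement of `m`. -/
def upperIndices (n : ℕ) : Set (Fin 2 × Fin n × Fin n) := {x | x.2.1 ≤ x.2.2}

theorem degree_pos {x : Fin 2 × Fin n × Fin n} (hx : x ∈ upperIndices n) : 0 < degree x := by
  have hx : (x.2.1 : ℕ) ≤ x.2.2 := hx
  rw [degree]
  omega

/-- The Kazhdan filtration of `Q_χ`. -/
def kazhdan (n : ℕ) : ℤ → Submodule ℂ (WhittakerModule n) :=
  wordSpan ℂ (fun x : Fin 2 × Fin n × Fin n => ι n (gen x.1 x.2.1 x.2.2)) degree (proj n 1)
    (upperIndices n)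

theorem kazhdan_mono (n : ℕ) : Monotone (kazhdan n) :=
  fun _ _ hd => wordSpan_mono subset_rfl hd

/-- The Kazhdan filtration of `U(Q(n))`, read off from its action on `Q_χ`. -/
def envKazhdan (n : ℕ) : ℤ → Submodule ℂ (Env n) := operatorFiltration (Env n) (kazhdan n)

theorem envKazhdan_mono {s t : ℤ} (hst : s ≤ t) : envKazhdan n s ≤ envKazhdan n t :=
  operatorFiltration_mono (kazhdan_mono n) hst

theorem smul_mem_kazhdan {s d d' : ℤ} {u : Env n} {v : WhittakerModule n}
    (hu : u ∈ envKazhdan n s) (hv : v ∈ kazhdan n d) (hd : d + s ≤ d') : u • v ∈ kazhdan n d' :=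
  kazhdan_mono n hd (hu d v hv)

theorem mul_mem_envKazhdan {s t r : ℤ} {u v : Env n} (hu : u ∈ envKazhdan n s)
    (hv : v ∈ envKazhdan n t) (hr : s + t ≤ r) : u * v ∈ envKazhdan n r :=
  envKazhdan_mono hr (mul_mem_operatorFiltration hu hv)

theorem algebraMap_mem_envKazhdan {s : ℤ} (c : ℂ) (hs : 0 ≤ s) :
    algebraMap ℂ (Env n) c ∈ envKazhdan n s :=
  envKazhdan_mono hs (algebraMap_mem_operatorFiltration c)

/-- The element `a - χ(a)` of `U(Q(n))`, where `a` is a basis element of `Q(n)`. -/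
def shiftedGen (p : Fin 2) (i j : Fin n) : Env n :=
  ι n (gen p i j) - algebraMap ℂ (Env n) (chi n (gen p i j))

theorem shiftedGen_mul (p q : Fin 2) (i j : Fin n) (u : Env n) :
    shiftedGen p i j * u =
      koszulSign p q • (u * shiftedGen p i j) + superComm p q (ι n (gen p i j)) u := by
  have sign_smul_chi : koszulSign p q * chi n (gen p i j) = chi n (gen p i j) := by
    rw [chi_gen]
    split_ifs with h
    · rw [h.1, koszulSign_zero_left, one_mul]
    · rw [mul_zero]
  simp only [shiftedGen, superComm_apply, sub_mul, mul_sub, smul_sub, ← Algebra.commutes _ u,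
    ← Algebra.smul_def, smul_smul, sign_smul_chi]
  abel

theorem shiftedGen_smul_eq_zero_iff {p : Fin 2} {i j : Fin n} {v : WhittakerModule n} :
    shiftedGen p i j • v = 0 ↔ ι n (gen p i j) • v = chi n (gen p i j) • v := by
  rw [shiftedGen, sub_smul, algebraMap_smul, sub_eq_zero]

theorem shiftedGen_smul_of_mem_whittakerVectors {v : WhittakerModule n}
    (hv : v ∈ whittakerVectors n) (p : Fin 2) {i j : Fin n} (hji : j < i) :
    shiftedGen p i j • v = 0 :=
  shiftedGen_smul_eq_zero_iff.2 (hv _ (gen_mem_nilM p hji))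

theorem gen_smul_mem_kazhdan {d : ℤ} {v : WhittakerModule n} {p : Fin 2} {i j : Fin n}
    (hv : v ∈ kazhdan n d)
    (lower : j < i → shiftedGen p i j • v ∈ kazhdan n (d + ((j : ℤ) - i))) :
    ι n (gen p i j) • v ∈ kazhdan n (d + ((j : ℤ) - i + 1)) := by
  rcases le_or_gt i j with hij | hji
  · refine smul_mem_wordSpan (x := (p, i, j)) hij (kazhdan_mono n ?_ hv)
    simp only [degree]
    omega
  · have split : ι n (gen p i j) • v = shiftedGen p i j • v + chi n (gen p i j) • v := by
      rw [shiftedGen, sub_smul, algebraMap_smul, sub_add_cancel]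
    rw [split, chi_gen]
    refine add_mem (kazhdan_mono n (by omega) (lower hji)) ?_
    split_ifs with h
    · rw [one_smul]
      exact kazhdan_mono n (by omega) hv
    · rw [zero_smul]
      exact zero_mem _

/-- Induction on words: moving `a - χ(a)` past a letter costs a commutator whose degree is one less
than expected. -/
theorem shiftedGen_mem_envKazhdan (p : Fin 2) {i j : Fin n} (hji : j < i) :
    shiftedGen p i j ∈ envKazhdan n ((j : ℤ) - i) := by
  let N (d : ℤ) : Submodule ℂ (WhittakerModule n) :=
    ⨅ (p : Fin 2) (i : Fin n) (j : Fin n) (_ : j < i),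
      (kazhdan n (d + ((j : ℤ) - i))).comap
        (Algebra.lsmul ℂ ℂ (WhittakerModule n) (shiftedGen p i j))
  have mem_N {d : ℤ} {v : WhittakerModule n} : v ∈ N d ↔
      ∀ (p : Fin 2) (i j : Fin n), j < i →
        shiftedGen p i j • v ∈ kazhdan n (d + ((j : ℤ) - i)) := by
    simp only [N, Submodule.mem_iInf, Submodule.mem_comap, Algebra.lsmul_coe]
  suffices kazhdan_le : ∀ d, kazhdan n d ≤ N d from
    fun d v hv => mem_N.1 (kazhdan_le d hv) p i j hji
  refine wordSpan_le (fun _ => degree_pos) (fun d _ => ?_) fun d ih x hx v hv => ?_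
  · refine mem_N.2 fun p i j hji => ?_
    rw [shiftedGen_smul_eq_zero_iff.2 (proj_gen _ (gen_mem_nilM p hji))]
    exact zero_mem _
  · obtain ⟨q, k, l⟩ := x
    change ι n (gen q k l) • v ∈ N d
    refine mem_N.2 fun p i j hji => ?_
    have ih := mem_N.1 (ih _ (sub_lt_self d (degree_pos hx)) hv)
    have gen_mem (r : Fin 2) (a b : Fin n) :
        ι n (gen r a b) • v ∈ kazhdan n (d - ((l : ℤ) - k + 1) + ((b : ℤ) - a + 1)) :=
      gen_smul_mem_kazhdan hv (ih r a b)
    rw [← mul_smul, shiftedGen_mul, superComm_gen_gen, add_smul, smul_assoc, mul_smul, sub_smul,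
      smul_assoc]
    refine add_mem (Submodule.smul_mem _ _ (smul_mem_wordSpan (x := (q, k, l)) hx
      (kazhdan_mono n (le_of_eq (by ring)) (ih p i j hji))))
      (sub_mem ?_ (Submodule.smul_mem _ _ ?_))
    all_goals split_ifs with h
    · subst h
      exact kazhdan_mono n (by omega) (gen_mem (p + q) i l)
    · rw [zero_smul]
      exact zero_mem _
    · subst h
      exact kazhdan_mono n (by omega) (gen_mem (p + q) k j)
    · rw [zero_smul]
      exact zero_mem _

end Kazhdan

section EnvelopingFiltration

variable {n : ℕ}

theorem gen_mem_envKazhdan (p : Fin 2) (i j : Fin n) :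
    ι n (gen p i j) ∈ envKazhdan n ((j : ℤ) - i + 1) :=
  fun d v hv => gen_smul_mem_kazhdan hv fun hji => shiftedGen_mem_envKazhdan p hji d v hv

theorem power_mem_envKazhdan (m : ℕ) (p : Fin 2) (i j : Fin n) :
    power m p i j ∈ envKazhdan n ((j : ℤ) - i + m) := by
  induction m generalizing p i with
  | zero =>
    rw [power_zero]
    split_ifs with h
    · rw [← map_one (algebraMap ℂ (Env n))]
      exact algebraMap_mem_envKazhdan 1 (by simp [h.2])
    · exact zero_mem _
  | succ m ih =>
    rw [power_succ]
    exact sum_mem fun q _ => Submodule.smul_mem _ _ <| sum_mem fun k _ =>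
      mul_mem_envKazhdan (gen_mem_envKazhdan q i k) (ih (p + q) k) (by push_cast; omega)

theorem exists_mem_envKazhdan (u : Env n) : ∃ d, u ∈ envKazhdan n d := by
  obtain ⟨a, rfl⟩ := RingQuot.mkAlgHom_surjective ℂ (EnvRel n) u
  induction a using TensorAlgebra.induction with
  | algebraMap c =>
    rw [AlgHom.commutes]
    exact ⟨0, algebraMap_mem_envKazhdan c le_rfl⟩
  | ι x =>
    change ∃ d, ι n x ∈ envKazhdan n d
    obtain ⟨A, B, rfl⟩ := exists_block x
    have gen_mem (p : Fin 2) (i j : Fin n) : ι n (gen p i j) ∈ envKazhdan n n :=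
      envKazhdan_mono (by omega) (gen_mem_envKazhdan p i j)
    refine ⟨n, ?_⟩
    simp only [block_eq_sum A B, map_sum, map_add, map_smul]
    exact sum_mem fun i _ => sum_mem fun j _ => add_mem (Submodule.smul_mem _ _ (gen_mem 0 i j))
      (Submodule.smul_mem _ _ (gen_mem 1 i j))
  | mul a b ha hb =>
    obtain ⟨s, hs⟩ := ha
    obtain ⟨t, ht⟩ := hb
    rw [map_mul]
    exact ⟨s + t, mul_mem_envKazhdan hs ht le_rfl⟩
  | add a b ha hb =>
    obtain ⟨s, hs⟩ := ha
    obtain ⟨t, ht⟩ := hb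
    rw [map_add]
    exact ⟨max s t, add_mem (envKazhdan_mono (le_max_left s t) hs)
      (envKazhdan_mono (le_max_right s t) ht)⟩

theorem proj_one_mem_kazhdan : proj n 1 ∈ kazhdan n 0 := self_mem_wordSpan le_rfl

theorem exists_mem_kazhdan (v : WhittakerModule n) : ∃ d, v ∈ kazhdan n d := by
  obtain ⟨u, rfl⟩ := proj_surjective n v
  obtain ⟨d, hu⟩ := exists_mem_envKazhdan u
  have hv : u • proj n 1 ∈ kazhdan n d := smul_mem_kazhdan hu proj_one_mem_kazhdan (zero_add d).le
  rw [← map_smul, smul_eq_mul, mul_one] at hv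
  exact ⟨d, hv⟩

end EnvelopingFiltration

section LeadingTerms

variable {n : ℕ}

/-- The difference between `e_{ij}^{(m+1)}` and `e_{i-1,j}^{(m)}`, or between `f_{ij}^{(m+1)}` and
`f_{i-1,j}^{(m)}`. -/
def powerRemainder (m : ℕ) (p : Fin 2) (i j : Fin n) : Env n :=
  ∑ q, koszulSign q m • ∑ k, shiftedGen q i k * power m (p + q) k j

theorem power_succ_eq_sum_add_powerRemainder (m : ℕ) (p : Fin 2) (i j : Fin n) :
    power (m + 1) p i j =
      (∑ k : Fin n, if (i : ℕ) = k + 1 then power m p k j else 0) + powerRemainder m p i j := by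
  simp only [power_succ, powerRemainder, shiftedGen, sub_mul, Finset.sum_sub_distrib, smul_sub,
    Fin.sum_univ_two, chi_gen, koszulSign_zero_left, one_smul, add_zero, true_and, one_ne_zero,
    false_and, if_false, map_zero, zero_mul, Finset.sum_const_zero, smul_zero,
    apply_ite (algebraMap ℂ (Env n)), map_one, ite_mul, one_mul]
  abel

theorem power_succ_of_succ_eq (m : ℕ) (p : Fin 2) {i k : Fin n} (j : Fin n) (hk : (k : ℕ) + 1 = i) :
    power (m + 1) p i j = power m p k j + powerRemainder m p i j := by
  have eq_iff (k' : Fin n) : (i : ℕ) = k' + 1 ↔ k' = k := by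
    rw [Fin.ext_iff]
    omega
  simp only [power_succ_eq_sum_add_powerRemainder, eq_iff, Finset.sum_ite_eq', Finset.mem_univ,
    if_true]

theorem power_succ_of_eq_zero (m : ℕ) (p : Fin 2) {i : Fin n} (j : Fin n) (hi : (i : ℕ) = 0) :
    power (m + 1) p i j = powerRemainder m p i j := by
  simp [power_succ_eq_sum_add_powerRemainder, hi]

theorem powerRemainder_mem {m : ℕ} {p : Fin 2} {i j : Fin n} {N : Submodule ℂ (Env n)}
    (h : ∀ q k, shiftedGen q i k * power m (p + q) k j ∈ N) : powerRemainder m p i j ∈ N :=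
  sum_mem fun q _ => Submodule.smul_mem _ _ (sum_mem fun k _ => h q k)

theorem shiftedGen_mul_power_mem_of_lt (m : ℕ) (p q : Fin 2) {i k : Fin n} (j : Fin n)
    (hki : k < i) : shiftedGen q i k * power m p k j ∈ envKazhdan n ((j : ℤ) - i + m) :=
  mul_mem_envKazhdan (shiftedGen_mem_envKazhdan q hki) (power_mem_envKazhdan m p k j) (by omega)

theorem shiftedGen_eq_gen (p : Fin 2) {i j : Fin n} (hij : i ≤ j) :
    shiftedGen p i j = ι n (gen p i j) := by
  rw [shiftedGen, chi_gen, if_neg (by omega), map_zero, sub_zero]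

theorem exists_succ_eq {i : Fin n} (hi : 0 < (i : ℕ)) : ∃ k : Fin n, (k : ℕ) + 1 = i :=
  ⟨⟨i - 1, (Nat.pred_le _).trans_lt i.2⟩, Nat.sub_add_cancel hi⟩

variable {l : Fin n} (hl : (l : ℕ) = 0)
include hl

theorem power_smodEq_of_le {m : ℕ} (p : Fin 2) {i : Fin n} (hmi : m ≤ i) :
    power m p i l ≡ if p = 0 ∧ m = i then 1 else 0 [SMOD envKazhdan n ((m : ℤ) - i - 1)] := by
  induction m generalizing p i with
  | zero =>
    have eq_iff : i = l ↔ 0 = (i : ℕ) := by rw [Fin.ext_iff, hl, eq_comm]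
    simp only [power_zero, eq_iff]
    rfl
  | succ m ih =>
    obtain ⟨k, hk⟩ := exists_succ_eq (m.succ_pos.trans_le hmi)
    have remainder_mem : powerRemainder m p i l ∈ envKazhdan n ((m : ℤ) - i) := by
      refine powerRemainder_mem fun q k => ?_
      rcases lt_or_ge k i with hki | hik
      · exact envKazhdan_mono (by omega) (shiftedGen_mul_power_mem_of_lt m (p + q) q l hki)
      · have power_mem := SModEq.zero.1 ((ih (p + q) (i := k) (by omega)).trans
          (by rw [if_neg (by omega)]))
        rw [shiftedGen_eq_gen q hik]
        exact mul_mem_envKazhdan (gen_mem_envKazhdan q i k) power_mem (by omega)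
    rw [power_succ_of_succ_eq m p l hk]
    have sum_smodEq := ((ih p (i := k) (by omega)).mono (envKazhdan_mono
      (t := ((m + 1 : ℕ) : ℤ) - i - 1) (by omega))).add
      (SModEq.zero.2 (envKazhdan_mono (t := ((m + 1 : ℕ) : ℤ) - i - 1) (by omega) remainder_mem))
    simpa [← hk] using sum_smodEq

theorem power_mem_of_lt {m : ℕ} (p : Fin 2) {i : Fin n} (hmi : m < i) :
    power m p i l ∈ envKazhdan n ((m : ℤ) - i - 1) := by
  simpa only [hmi.ne, and_false, if_false, SModEq.zero] using power_smodEq_of_le hl p hmi.le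

omit hl in
/-- The span of the products, of degree at most `s`, whose first factor lies on or above the
diagonal and either outside the last column or in the last column with degree less than `s`,
together with everything of degree less than `s`. -/
def decomposable (n : ℕ) (s : ℤ) : Submodule ℂ (Env n) :=
  Submodule.span ℂ {u | ∃ (q : Fin 2) (k b : Fin n), k ≤ b ∧ ((b : ℕ) + 1 < n ∨ (n : ℤ) - k < s) ∧
    ∃ x ∈ envKazhdan n (s - ((b : ℤ) - k + 1)), ι n (gen q k b) * x = u} ⊔ envKazhdan n (s - 1)

theorem shiftedGen_mul_power_mem_decomposable {m : ℕ} (p q : Fin 2) (i : Fin n) {k : Fin n}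
    (hk : (k : ℕ) = m → m + 1 ≠ n) :
    shiftedGen q i k * power m p k l ∈ decomposable n ((m + 1 : ℕ) - i) := by
  rcases lt_or_ge k i with hki | hik
  · exact Submodule.mem_sup_right (envKazhdan_mono (by push_cast; omega)
      (shiftedGen_mul_power_mem_of_lt m p q l hki))
  · rw [shiftedGen_eq_gen q hik]
    rcases lt_or_ge m k with hmk | hkm
    · exact Submodule.mem_sup_right (mul_mem_envKazhdan (gen_mem_envKazhdan q i k)
        (power_mem_of_lt hl p hmk) (by push_cast; omega))
    · exact Submodule.mem_sup_left (Submodule.subset_span ⟨q, i, k, hik, by push_cast; omega, _,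
        envKazhdan_mono (by push_cast; omega) (power_mem_envKazhdan m p k l), rfl⟩)

theorem powerRemainder_mem_decomposable {m : ℕ} (p : Fin 2) (i : Fin n) (hm : m + 1 ≠ n) :
    powerRemainder m p i l ∈ decomposable n ((m + 1 : ℕ) - i) :=
  powerRemainder_mem fun q _ => shiftedGen_mul_power_mem_decomposable hl (p + q) q i fun _ => hm

theorem power_mem_decomposable {m : ℕ} (p : Fin 2) {i : Fin n} (him : (i : ℕ) < m) (hmn : m < n) :
    power m p i l ∈ decomposable n (m - i) := by
  induction m generalizing i with
  | zero => exact absurd him (Nat.not_lt_zero _)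
  | succ m ih =>
    have remainder_mem := powerRemainder_mem_decomposable hl p i hmn.ne
    rcases Nat.eq_zero_or_pos i with hi | hi
    · rwa [power_succ_of_eq_zero m p l hi]
    · obtain ⟨k, hk⟩ := exists_succ_eq hi
      have degree_eq : ((m + 1 : ℕ) : ℤ) - i = m - k := by push_cast; omega
      rw [power_succ_of_succ_eq m p l hk]
      rw [degree_eq] at remainder_mem ⊢
      exact add_mem (ih (by omega) (by omega)) remainder_mem

variable {b : Fin n} (hb : (b : ℕ) + 1 = n)
include hb

theorem powerRemainder_smodEq (p : Fin 2) (i : Fin n) :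
    powerRemainder b p i l ≡ koszulSign p b • ι n (gen p i b)
      [SMOD decomposable n ((b + 1 : ℕ) - i)] := by
  have hib : i ≤ b := Fin.le_def.2 (by omega)
  have term_smodEq (q : Fin 2) (k : Fin n) : shiftedGen q i k * power b (p + q) k l ≡
      if q = p ∧ k = b then ι n (gen p i b) else 0 [SMOD decomposable n ((b + 1 : ℕ) - i)] := by
    by_cases hk : k = b
    · subst hk
      have add_eq_zero : p + q = 0 ↔ q = p := by revert p q; decide
      have leading : (if q = p ∧ k = k then ι n (gen p i k) else 0) =
          ι n (gen q i k) * if p + q = 0 ∧ (k : ℕ) = k then 1 else 0 := by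
        simp only [add_eq_zero, and_true, mul_ite, mul_one, mul_zero]
        split_ifs with hqp
        · rw [hqp]
        · rfl
      rw [leading, shiftedGen_eq_gen q hib, SModEq.sub_mem, ← mul_sub]
      exact Submodule.mem_sup_right (mul_mem_envKazhdan (gen_mem_envKazhdan q i k)
        (SModEq.sub_mem.1 (power_smodEq_of_le hl (p + q) le_rfl)) (by push_cast; omega))
    · rw [if_neg fun h => hk h.2, SModEq.zero]
      exact shiftedGen_mul_power_mem_decomposable hl (p + q) q i fun h => absurd (Fin.ext h) hk
  have sum_eq : koszulSign p b • ι n (gen p i b) =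
      ∑ q, koszulSign q b • ∑ k, if q = p ∧ k = b then ι n (gen p i b) else 0 := by
    simp [ite_and]
  rw [sum_eq]
  exact SModEq.sum fun q _ => (SModEq.sum fun k _ => term_smodEq q k).smul _

theorem power_smodEq (p : Fin 2) {m : ℕ} (hbm : b ≤ m) {i k : Fin n} (hk : (k : ℕ) + m = b + i) :
    power (m + 1) p i l ≡ koszulSign p b • ι n (gen p k b)
      [SMOD decomposable n ((m + 1 : ℕ) - i)] := by
  induction m, hbm using Nat.le_induction generalizing i with
  | base =>
    obtain rfl : k = i := Fin.ext (by omega)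
    have remainder_smodEq := powerRemainder_smodEq hl hb p k
    rcases Nat.eq_zero_or_pos k with hk | hk
    · rwa [power_succ_of_eq_zero b p l hk]
    · obtain ⟨j, hj⟩ := exists_succ_eq hk
      have degree_eq : ((b + 1 : ℕ) : ℤ) - k = (b : ℕ) - j := by push_cast; omega
      rw [power_succ_of_succ_eq b p l hj]
      rw [degree_eq] at remainder_smodEq ⊢
      have sum_smodEq :=
        (SModEq.zero.2 (power_mem_decomposable hl p (m := b) (by omega) b.2)).add remainder_smodEq
      rwa [zero_add] at sum_smodEq
  | succ m hbm ih =>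
    obtain ⟨j, hj⟩ := exists_succ_eq (i := i) (by omega)
    have remainder_mem := powerRemainder_mem_decomposable hl (m := m + 1) p i (by omega)
    have degree_eq : ((m + 1 + 1 : ℕ) : ℤ) - i = (m + 1 : ℕ) - j := by push_cast; omega
    rw [power_succ_of_succ_eq (m + 1) p l hj]
    rw [degree_eq] at remainder_mem ⊢
    have sum_smodEq := (ih (i := j) (by omega)).add (SModEq.zero.2 remainder_mem)
    rwa [add_zero] at sum_smodEq

end LeadingTerms

section Letters

variable {n : ℕ}

/-- The basis elements of `Q(n)` on or above the diagonal, except that those in the last column are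
replaced by the elements `e_{n,1}^{(m)}` and `f_{n,1}^{(m)}` of the same degree. -/
def letter (x : Fin 2 × Fin n × Fin n) : Env n :=
  if (x.2.2 : ℕ) + 1 = n then power (2 * n - 1 - x.2.1) x.1 x.2.2 ⟨0, x.2.1.pos⟩
  else ι n (gen x.1 x.2.1 x.2.2)

/-- The analogue of the Kazhdan filtration for words in the letters indexed by `S`. -/
abbrev letterSpan (S : Set (Fin 2 × Fin n × Fin n)) : ℤ → Submodule ℂ (WhittakerModule n) :=
  wordSpan ℂ letter degree (proj n 1) S

theorem letter_eq_power (p : Fin 2) (i : Fin n) {j : Fin n} (hj : (j : ℕ) + 1 = n) :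
    letter (p, i, j) = power (2 * n - 1 - i) p j ⟨0, i.pos⟩ := if_pos hj

theorem letter_eq_gen (p : Fin 2) (i : Fin n) {j : Fin n} (hj : (j : ℕ) + 1 ≠ n) :
    letter (p, i, j) = ι n (gen p i j) := if_neg hj

theorem letter_mem_envKazhdan (x : Fin 2 × Fin n × Fin n) : letter x ∈ envKazhdan n (degree x) := by
  obtain ⟨p, i, j⟩ := x
  by_cases hj : (j : ℕ) + 1 = n
  · rw [letter_eq_power p i hj]
    exact envKazhdan_mono (by simp only [degree]; omega) (power_mem_envKazhdan _ p j _)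
  · rw [letter_eq_gen p i hj]
    exact gen_mem_envKazhdan p i j

theorem letter_smodEq (p : Fin 2) (i : Fin n) {j : Fin n} (hj : (j : ℕ) + 1 = n) :
    letter (p, i, j) ≡ koszulSign p j • ι n (gen p i j)
      [SMOD decomposable n ((j : ℤ) - i + 1)] := by
  obtain ⟨m, hm⟩ : ∃ m, 2 * n - 1 - i = m + 1 := ⟨2 * n - 2 - i, by omega⟩
  have degree_eq : (j : ℤ) - i + 1 = (m + 1 : ℕ) - j := by push_cast; omega
  rw [letter_eq_power p i hj, hm, degree_eq]
  exact power_smodEq rfl hj p (by omega) (by omega)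

theorem letterSpan_le_kazhdan {S : Set (Fin 2 × Fin n × Fin n)} (hS : S ⊆ upperIndices n) (d : ℤ) :
    letterSpan S d ≤ kazhdan n d :=
  wordSpan_le (fun _ hx => degree_pos (hS hx)) (fun _ => self_mem_wordSpan)
    (fun d ih x hx _ hv => smul_mem_kazhdan (letter_mem_envKazhdan x)
      (ih _ (sub_lt_self d (degree_pos (hS hx))) hv) (sub_add_cancel d _).le) d

theorem decomposable_smul_mem {s d : ℤ} {N : Submodule ℂ (WhittakerModule n)}
    {v : WhittakerModule n} (hv : v ∈ kazhdan n (d - s)) (lower : kazhdan n (d - 1) ≤ N)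
    (gen_smul : ∀ (q : Fin 2) (k b : Fin n), k ≤ b → ((b : ℕ) + 1 < n ∨ (n : ℤ) - k < s) →
      ∀ w ∈ kazhdan n (d - ((b : ℤ) - k + 1)), ι n (gen q k b) • w ∈ N)
    {u : Env n} (hu : u ∈ decomposable n s) : u • v ∈ N := by
  let smul_v := (LinearMap.toSpanSingleton (Env n) (WhittakerModule n) v).restrictScalars ℂ
  suffices decomposable_le : decomposable n s ≤ N.comap smul_v from decomposable_le hu
  refine sup_le (Submodule.span_le.2 ?_) fun u hu => lower (smul_mem_kazhdan hu hv (by omega))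
  rintro _ ⟨q, k, b, hkb, hb, x, hx, rfl⟩
  change (ι n (gen q k b) * x) • v ∈ N
  rw [mul_smul]
  exact gen_smul q k b hkb hb _ (smul_mem_kazhdan hx hv (by omega))

/-- By induction on the degree of the basis element. In the last column it is, up to a nonzero
factor, the leading term of its letter, and the other terms involve basis elements that come
earlier. -/
theorem gen_smul_mem_letterSpan {d : ℤ}
    (ih : ∀ d' < d, kazhdan n d' ≤ letterSpan (upperIndices n) d') (p : Fin 2) {i j : Fin n}
    (hij : i ≤ j) {v : WhittakerModule n} (hv : v ∈ kazhdan n (d - ((j : ℤ) - i + 1))) :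
    ι n (gen p i j) • v ∈ letterSpan (upperIndices n) d := by
  have letter_mem {q : Fin 2} {k b : Fin n} (hkb : k ≤ b) {w : WhittakerModule n}
      (hw : w ∈ kazhdan n (d - ((b : ℤ) - k + 1))) :
      letter (q, k, b) • w ∈ letterSpan (upperIndices n) d :=
    smul_mem_wordSpan (x := (q, k, b)) hkb (ih _ (sub_lt_self d (degree_pos hkb)) hw)
  by_cases hj : (j : ℕ) + 1 = n
  · induction hr : n - (i : ℕ) using Nat.strong_induction_on generalizing p i v with
    | _ r ih_degree =>
    have remainder_mem : (letter (p, i, j) - koszulSign p j • ι n (gen p i j)) • v ∈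
        letterSpan (upperIndices n) d := by
      refine decomposable_smul_mem hv
        ((ih _ (sub_one_lt d)).trans (wordSpan_mono subset_rfl (sub_one_lt d).le))
        (fun q k b hkb hb w hw => ?_) (SModEq.sub_mem.1 (letter_smodEq p i hj))
      by_cases hbj : (b : ℕ) + 1 = n
      · obtain rfl : b = j := Fin.ext (by omega)
        exact ih_degree _ (by omega) q hkb hw rfl
      · exact letter_eq_gen q k hbj ▸ letter_mem hkb hw
    rw [sub_smul, smul_assoc, Submodule.sub_mem_iff_right _ (letter_mem hij hv)] at remainder_mem
    exact (Submodule.smul_mem_iff _ (koszulSign_ne_zero p j)).1 remainder_mem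
  · exact letter_eq_gen p i hj ▸ letter_mem hij hv

theorem kazhdan_le_letterSpan (d : ℤ) : kazhdan n d ≤ letterSpan (upperIndices n) d :=
  wordSpan_le (fun _ => degree_pos) (fun _ => self_mem_wordSpan)
    (fun _ ih x hx _ hv => gen_smul_mem_letterSpan ih x.1 hx hv) d

end Letters

theorem mem_of_mem_iSup_comap_sub {K M : Type*} [Field K] [AddCommGroup M] [Module K M]
    {E : Module.End K M} {N : Submodule K M} (hE : N ≤ N.comap E) {v : M}
    (hv : v ∈ ⨆ (c : K) (_ : c ≠ 0), N.comap (E - algebraMap K (Module.End K M) c))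
    (hEv : E v ∈ N) : v ∈ N := by
  let quotE : Module.End K (M ⧸ N) := N.mapQ N E hE
  have eigen_of_sub_mem (c : K) {u : M} (hu : E u - c • u ∈ N) :
      N.mkQ u ∈ quotE.eigenspace c := by
    rw [Module.End.mem_eigenspace_iff]
    exact (Submodule.Quotient.eq N).2 hu
  have mem_iSup : N.mkQ v ∈ ⨆ (c : K) (_ : c ≠ 0), quotE.eigenspace c := by
    suffices h : ⨆ (c : K) (_ : c ≠ 0), N.comap (E - algebraMap K (Module.End K M) c) ≤
        (⨆ (c : K) (_ : c ≠ 0), quotE.eigenspace c).comap N.mkQ from h hv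
    exact iSup₂_le fun c hc u hu =>
      Submodule.mem_iSup_of_mem c (Submodule.mem_iSup_of_mem hc (eigen_of_sub_mem c hu))
  have mem_zero : N.mkQ v ∈ quotE.eigenspace 0 := eigen_of_sub_mem 0 (by simpa using hEv)
  exact (Submodule.Quotient.mk_eq_zero N).1
    (Submodule.disjoint_def.1 (quotE.eigenspaces_iSupIndep 0) _ mem_zero mem_iSup)

section LeadingEigenspaces

variable {n : ℕ}

/-- The vectors of Kazhdan degree at most `d` on which `u` acts as the scalar `c` up to vectors of
smaller degree. -/
def leadingEigenspace (u : Env n) (d : ℤ) (c : ℂ) : Submodule ℂ (WhittakerModule n) :=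
  kazhdan n d ⊓ (kazhdan n (d - 1)).comap
    (Algebra.lsmul ℂ ℂ (WhittakerModule n) u - algebraMap ℂ (Module.End ℂ (WhittakerModule n)) c)

variable {u a : Env n} {d : ℤ} {c : ℂ} {v : WhittakerModule n}

theorem mem_leadingEigenspace :
    v ∈ leadingEigenspace u d c ↔ v ∈ kazhdan n d ∧ u • v - c • v ∈ kazhdan n (d - 1) := Iff.rfl

theorem kazhdan_le_leadingEigenspace (hu : u ∈ envKazhdan n 0) :
    kazhdan n (d - 1) ≤ leadingEigenspace u d c := fun _ hv =>
  ⟨kazhdan_mono n (sub_one_lt d).le hv,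
    sub_mem (smul_mem_kazhdan hu hv (add_zero _).le) (Submodule.smul_mem _ c hv)⟩

theorem smul_mem_leadingEigenspace {t : ℤ} {r s : ℂ} (ha : a ∈ envKazhdan n t)
    (hua : u * a - a * (r • u + algebraMap ℂ (Env n) s) ∈ envKazhdan n (t - 1))
    (hv : v ∈ leadingEigenspace u (d - t) c) : a • v ∈ leadingEigenspace u d (r * c + s) := by
  obtain ⟨hv, huv⟩ := mem_leadingEigenspace.1 hv
  refine mem_leadingEigenspace.2 ⟨smul_mem_kazhdan ha hv (by omega), ?_⟩
  have split : u • a • v - (r * c + s) • a • v =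
      (u * a - a * (r • u + algebraMap ℂ (Env n) s)) • v + r • a • (u • v - c • v) := by
    simp only [sub_smul, mul_smul, mul_add, add_smul, smul_sub, smul_assoc, mul_smul_comm,
      algebraMap_smul, smul_comm a]
    abel
  rw [split]
  exact add_mem (smul_mem_kazhdan hua hv (by omega))
    (Submodule.smul_mem _ r (smul_mem_kazhdan ha huv (by omega)))

end LeadingEigenspaces

section Elimination

variable {n : ℕ}

theorem superComm_gen_letter_mem (p q : Fin 2) (i j k l : Fin n) :
    superComm p q (ι n (gen p i j)) (letter (q, k, l)) ∈
      envKazhdan n ((j : ℤ) - i + degree (q, k, l)) := by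
  simp only [degree]
  by_cases hl : (l : ℕ) + 1 = n
  · rw [letter_eq_power q k hl, superComm_gen_power]
    refine sub_mem (Submodule.smul_mem _ _ ?_) (Submodule.smul_mem _ _ ?_) <;> split_ifs with h
    · subst h
      exact envKazhdan_mono (by dsimp only; omega) (power_mem_envKazhdan _ (p + q) i _)
    · exact zero_mem _
    · subst h
      exact envKazhdan_mono (by dsimp only; omega) (power_mem_envKazhdan _ (p + q) l j)
    · exact zero_mem _
  · rw [letter_eq_gen q k hl, superComm_gen_gen]
    refine sub_mem ?_ (Submodule.smul_mem _ _ ?_) <;> split_ifs with h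
    · subst h
      exact envKazhdan_mono (by omega) (gen_mem_envKazhdan (p + q) i l)
    · exact zero_mem _
    · subst h
      exact envKazhdan_mono (by omega) (gen_mem_envKazhdan (p + q) k j)
    · exact zero_mem _

variable {i j j' : Fin n}

/-- To leading order, commuting with the basis element at `(j + 1, i)`, which lies in `m`, is the
derivative with respect to the letter `(p, i, j)`: the value `1` of `χ` produces the constant. -/
theorem superComm_gen_letter_sub_mem (hij : i ≤ j) (hj' : (j' : ℕ) = j + 1) (p q : Fin 2)
    {k l : Fin n} (hl : (l : ℕ) + 1 = n ∨ l ≤ j) :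
    superComm p q (ι n (gen p j' i)) (letter (q, k, l)) -
        algebraMap ℂ (Env n) (if (q, k, l) = (p, i, j) then 1 else 0) ∈
      envKazhdan n (degree (q, k, l) - degree (p, i, j) - 1) := by
  by_cases hln : (l : ℕ) + 1 = n
  · have ne : (q, k, l) ≠ (p, i, j) := by rintro ⟨⟩; omega
    rw [letter_eq_power q k hln, superComm_gen_power, if_neg (by omega),
      if_neg (fun h => by simp [h] at hj'), if_neg ne]
    simp
  · have hlj : l ≤ j := hl.resolve_left hln
    rw [letter_eq_gen q k hln, superComm_gen_gen, if_neg (c := j' = l) (by omega), smul_zero,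
      sub_zero]
    by_cases hik : i = k
    · subst hik
      have chi_eq : chi n (gen (p + q) j' l) = if (q, i, l) = (p, i, j) then 1 else 0 := by
        have add_eq_zero : ∀ p q : Fin 2, p + q = 0 ↔ q = p := by decide
        simp only [chi_gen, add_eq_zero, hj', add_left_inj, Prod.mk.injEq, true_and, Fin.ext_iff,
          eq_comm]
      rw [if_pos rfl, ← chi_eq]
      exact envKazhdan_mono (by simp only [degree]; omega)
        (shiftedGen_mem_envKazhdan (p + q) (i := j') (j := l) (by omega))
    · have ne : (q, k, l) ≠ (p, i, j) := by rintro ⟨⟩; exact hik rfl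
      rw [if_neg hik, if_neg ne]
      simp

theorem shiftedGen_smul_mem_kazhdan {S : Set (Fin 2 × Fin n × Fin n)} (hS : S ⊆ upperIndices n)
    (hij : i ≤ j) (hj' : (j' : ℕ) = j + 1) {p : Fin 2} (hpij : (p, i, j) ∉ S)
    (hcol : ∀ x ∈ S, (x.2.2 : ℕ) + 1 = n ∨ x.2.2 ≤ j) {d : ℤ} {v : WhittakerModule n}
    (hv : v ∈ letterSpan S d) :
    shiftedGen p j' i • v ∈ kazhdan n (d - degree (p, i, j) - 1) := by
  have hij' : i < j' := by omega
  let N (d : ℤ) : Submodule ℂ (WhittakerModule n) :=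
    (kazhdan n (d - degree (p, i, j) - 1)).comap
      (Algebra.lsmul ℂ ℂ (WhittakerModule n) (shiftedGen p j' i))
  suffices le_N : letterSpan S d ≤ N d from le_N hv
  refine wordSpan_le (fun x hx => degree_pos (hS hx)) (fun d _ => ?_) (fun d ih x hx v hv => ?_) d
  · change shiftedGen p j' i • proj n 1 ∈ kazhdan n (d - degree (p, i, j) - 1)
    rw [shiftedGen_smul_eq_zero_iff.2 (proj_gen _ (gen_mem_nilM p hij'))]
    exact zero_mem _
  · obtain ⟨q, k, l⟩ := x
    have comm_mem := superComm_gen_letter_sub_mem hij hj' p q (k := k) (l := l) (hcol _ hx)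
    rw [if_neg (ne_of_mem_of_not_mem hx hpij), map_zero, sub_zero] at comm_mem
    change shiftedGen p j' i • letter (q, k, l) • v ∈ kazhdan n (d - degree (p, i, j) - 1)
    rw [← mul_smul, shiftedGen_mul p q, add_smul, smul_assoc, mul_smul]
    exact add_mem (Submodule.smul_mem _ _ (smul_mem_kazhdan (letter_mem_envKazhdan _)
      (ih _ (sub_lt_self d (degree_pos (hS hx))) hv) (by omega)))
      (smul_mem_kazhdan comm_mem (letterSpan_le_kazhdan hS _ hv) (by omega))

/-- The operator that acts on leading terms as the Euler operator counting the letters `(p, i, j)`,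
when `j'` is the index after `j`. -/
def euler (p : Fin 2) (i j j' : Fin n) : Env n := ι n (gen p i j) * shiftedGen p j' i

theorem euler_mul (p q : Fin 2) (i j j' : Fin n) (u : Env n) :
    euler p i j j' * u = u * euler p i j j' +
      koszulSign p q • (superComm p q (ι n (gen p i j)) u * shiftedGen p j' i) +
      ι n (gen p i j) * superComm p q (ι n (gen p j' i)) u := by
  rw [euler, mul_assoc, shiftedGen_mul p q, superComm_apply p q (ι n (gen p i j))]
  simp only [mul_add, sub_mul, smul_sub, mul_smul_comm, smul_mul_assoc, smul_smul,
    koszulSign_mul_self, one_smul, mul_assoc]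
  abel

theorem euler_mem_envKazhdan (p : Fin 2) (hj' : (j' : ℕ) = j + 1) (hij : i ≤ j) :
    euler p i j j' ∈ envKazhdan n 0 :=
  mul_mem_envKazhdan (gen_mem_envKazhdan p i j)
    (shiftedGen_mem_envKazhdan p (i := j') (j := i) (by omega)) (by omega)

variable {S : Set (Fin 2 × Fin n × Fin n)} {p : Fin 2} {d : ℤ} {c : ℂ} {v : WhittakerModule n}

theorem letterSpan_le_leadingEigenspace (hS : S ⊆ upperIndices n) (hij : i ≤ j)
    (hj' : (j' : ℕ) = j + 1) (hpij : (p, i, j) ∉ S)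
    (hcol : ∀ x ∈ S, (x.2.2 : ℕ) + 1 = n ∨ x.2.2 ≤ j) :
    letterSpan S d ≤ leadingEigenspace (euler p i j j') d 0 := by
  refine fun v hv => mem_leadingEigenspace.2 ⟨letterSpan_le_kazhdan hS d hv, ?_⟩
  rw [zero_smul, sub_zero, euler, mul_smul]
  exact smul_mem_kazhdan (gen_mem_envKazhdan p i j)
    (shiftedGen_smul_mem_kazhdan hS hij hj' hpij hcol hv) (by simp only [degree]; omega)

theorem letter_smul_mem_leadingEigenspace_of_ne (hij : i ≤ j) (hj' : (j' : ℕ) = j + 1)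
    {x : Fin 2 × Fin n × Fin n} (hx : x ≠ (p, i, j)) (hcol : (x.2.2 : ℕ) + 1 = n ∨ x.2.2 ≤ j)
    (hv : v ∈ leadingEigenspace (euler p i j j') (d - degree x) c) :
    letter x • v ∈ leadingEigenspace (euler p i j j') d c := by
  obtain ⟨q, k, l⟩ := x
  have comm_mem := superComm_gen_letter_sub_mem hij hj' p q (k := k) hcol
  rw [if_neg hx, map_zero, sub_zero] at comm_mem
  have lower := smul_mem_leadingEigenspace (r := 1) (s := 0) (letter_mem_envKazhdan (q, k, l))
    (u := euler p i j j') ?_ hv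
  · rwa [one_mul, add_zero] at lower
  rw [one_smul, map_zero, add_zero, euler_mul p q, add_sub_right_comm, add_sub_cancel_left]
  refine add_mem (Submodule.smul_mem _ _ ?_)
    (mul_mem_envKazhdan (gen_mem_envKazhdan p i j) comm_mem (by simp only [degree]; omega))
  exact mul_mem_envKazhdan (superComm_gen_letter_mem p q i j k l)
    (shiftedGen_mem_envKazhdan p (i := j') (j := i) (by omega)) (by omega)

theorem letter_smul_mem_leadingEigenspace_self (hij : i ≤ j) (hj' : (j' : ℕ) = j + 1)
    (hv : v ∈ leadingEigenspace (euler p i j j') (d - degree (p, i, j)) c) :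
    letter (p, i, j) • v ∈ leadingEigenspace (euler p i j j') d (koszulSign p p * c + 1) := by
  refine smul_mem_leadingEigenspace (letter_mem_envKazhdan _) ?_ hv
  have comm_mem := superComm_gen_letter_sub_mem hij hj' p p (k := i) (.inr le_rfl)
  rw [if_pos rfl] at comm_mem
  rw [letter_eq_gen p i (by omega)] at comm_mem ⊢
  rw [euler, mul_assoc, shiftedGen_mul p p, ← mul_sub, add_sub_add_left_eq_sub]
  exact mul_mem_envKazhdan (gen_mem_envKazhdan p i j) comm_mem (by simp only [degree]; omega)

/-- The square of an odd letter is half a supercommutator, hence has smaller degree than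
expected. -/
theorem letter_smul_mem_kazhdan_of_odd (hij : i ≤ j) (hj' : (j' : ℕ) = j + 1) (hc : c ≠ 0)
    (hv : v ∈ leadingEigenspace (euler 1 i j j') (d - degree ((1 : Fin 2), i, j)) c) :
    letter (1, i, j) • v ∈ kazhdan n (d - 1) := by
  obtain ⟨hv, euler_v⟩ := mem_leadingEigenspace.1 hv
  have square_mem := superComm_gen_letter_mem 1 1 i j i j
  rw [letter_eq_gen 1 i (by omega), superComm_apply, Fin.val_one, koszulSign_one_left, pow_one,
    neg_one_smul, sub_neg_eq_add, ← two_smul ℂ, Submodule.smul_mem_iff _ two_ne_zero] at square_mem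
  have shifted_v := smul_mem_kazhdan (shiftedGen_mem_envKazhdan 1 (i := j') (j := i) (by omega)) hv
    le_rfl
  have split : c • ι n (gen 1 i j) • v =
      (ι n (gen 1 i j) * ι n (gen 1 i j)) • shiftedGen 1 j' i • v -
        ι n (gen 1 i j) • (euler 1 i j j' • v - c • v) := by
    rw [euler, smul_sub, smul_comm (ι n (gen 1 i j)) c, mul_smul, mul_smul, sub_sub_cancel]
  rw [letter_eq_gen 1 i (by omega), ← Submodule.smul_mem_iff _ hc, split]
  exact sub_mem (smul_mem_kazhdan square_mem shifted_v (by simp only [degree]; omega))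
    (smul_mem_kazhdan (gen_mem_envKazhdan 1 i j) euler_v (by simp only [degree]; omega))

theorem exists_letter_smul_mem_leadingEigenspace (hij : i ≤ j) (hj' : (j' : ℕ) = j + 1) {c : ℕ}
    (hv : v ∈ leadingEigenspace (euler p i j j') (d - degree (p, i, j)) (c + 1)) :
    ∃ c' : ℕ, letter (p, i, j) • v ∈ leadingEigenspace (euler p i j j') d (c' + 1) := by
  match p with
  | 0 =>
    refine ⟨c + 1, ?_⟩
    have raised := letter_smul_mem_leadingEigenspace_self hij hj' hv
    rwa [koszulSign_zero_left, one_mul, ← Nat.cast_add_one] at raised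
  | 1 => exact ⟨0, kazhdan_le_leadingEigenspace (euler_mem_envKazhdan 1 hj' hij)
      (letter_smul_mem_kazhdan_of_odd hij hj' c.cast_add_one_ne_zero hv)⟩

theorem letterSpan_insert_le (hS : S ⊆ upperIndices n) (hij : i ≤ j) (hj' : (j' : ℕ) = j + 1)
    (hpij : (p, i, j) ∉ S) (hcol : ∀ x ∈ S, (x.2.2 : ℕ) + 1 = n ∨ x.2.2 ≤ j) :
    letterSpan (insert (p, i, j) S) d ≤
      letterSpan S d ⊔ ⨆ c : ℕ, leadingEigenspace (euler p i j j') d (c + 1) := by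
  have degree_pos : ∀ x ∈ insert (p, i, j) S, 0 < degree x :=
    Set.forall_mem_insert.2 ⟨degree_pos hij, fun x hx => degree_pos (hS hx)⟩
  let P (d : ℤ) : Submodule ℂ (WhittakerModule n) :=
    letterSpan S d ⊔ ⨆ c : ℕ, leadingEigenspace (euler p i j j') d (c + 1)
  refine wordSpan_le (N := P) degree_pos
    (fun d hd => Submodule.mem_sup_left (self_mem_wordSpan hd)) (fun d ih x hx v hv => ?_) d
  suffices step :
      P (d - degree x) ≤ (P d).comap (Algebra.lsmul ℂ ℂ (WhittakerModule n) (letter x)) from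
    step (ih _ (sub_lt_self d (degree_pos x hx)) hv)
  rcases hx with rfl | hx
  · refine sup_le (fun w hw => ?_) (iSup_le fun c u hu => ?_)
    · have raised := letter_smul_mem_leadingEigenspace_self hij hj'
        (letterSpan_le_leadingEigenspace hS hij hj' hpij hcol hw)
      rw [mul_zero, ← Nat.cast_zero] at raised
      exact Submodule.mem_sup_right (Submodule.mem_iSup_of_mem 0 raised)
    · obtain ⟨c', raised⟩ := exists_letter_smul_mem_leadingEigenspace hij hj' hu
      exact Submodule.mem_sup_right (Submodule.mem_iSup_of_mem c' raised)
  · refine sup_le (fun w hw => ?_) (iSup_le fun c u hu => ?_)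
    · exact Submodule.mem_sup_left (smul_mem_wordSpan hx hw)
    · exact Submodule.mem_sup_right (Submodule.mem_iSup_of_mem c
        (letter_smul_mem_leadingEigenspace_of_ne hij hj' (ne_of_mem_of_not_mem hx hpij)
          (hcol x hx) hu))

/-- A Whittaker vector is annihilated by the Euler operator, so its leading term does not involve
the letter `(p, i, j)`. -/
theorem mem_letterSpan_of_mem_letterSpan_insert (hS : S ⊆ upperIndices n) (hij : i ≤ j)
    (hjn : (j : ℕ) + 1 ≠ n) (hpij : (p, i, j) ∉ S)
    (hcol : ∀ x ∈ S, (x.2.2 : ℕ) + 1 = n ∨ x.2.2 ≤ j) (hv : v ∈ whittakerVectors n)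
    (hvd : v ∈ letterSpan (insert (p, i, j) S) d ⊔ kazhdan n (d - 1)) :
    v ∈ letterSpan S d ⊔ kazhdan n (d - 1) := by
  obtain ⟨j', hj'⟩ : ∃ j' : Fin n, (j' : ℕ) = j + 1 := ⟨⟨j + 1, by omega⟩, rfl⟩
  let E := Algebra.lsmul ℂ ℂ (WhittakerModule n) (euler p i j j')
  have euler_mem := euler_mem_envKazhdan p hj' hij
  have lower_le : kazhdan n (d - 1) ≤ ⨆ c : ℕ, leadingEigenspace (euler p i j j') d (c + 1) :=
    (kazhdan_le_leadingEigenspace euler_mem).trans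
      (le_iSup (fun c : ℕ => leadingEigenspace (euler p i j j') d (c + 1)) 0)
  obtain ⟨w, hw, u, hu, rfl⟩ := Submodule.mem_sup.1
    (sup_le (letterSpan_insert_le hS hij hj' hpij hcol) (lower_le.trans le_sup_right) hvd)
  have euler_w : E w ∈ kazhdan n (d - 1) := by
    have eigen_w := mem_leadingEigenspace.1
      (letterSpan_le_leadingEigenspace hS hij hj' hpij hcol hw)
    rw [zero_smul, sub_zero] at eigen_w
    exact eigen_w.2
  have euler_add : E w + E u = 0 := by
    rw [← map_add]
    change (ι n (gen p i j) * shiftedGen p j' i) • (w + u) = 0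
    rw [mul_smul, shiftedGen_smul_of_mem_whittakerVectors hv p (by omega), smul_zero]
  have eigenspaces_le : ⨆ c : ℕ, leadingEigenspace (euler p i j j') d (c + 1) ≤
      ⨆ (c : ℂ) (_ : c ≠ 0), (kazhdan n (d - 1)).comap (E - algebraMap ℂ _ c) :=
    iSup_le fun c => le_iSup₂_of_le (c + 1) c.cast_add_one_ne_zero inf_le_right
  exact Submodule.add_mem_sup hw (mem_of_mem_iSup_comap_sub (E := E)
    (fun z hz => smul_mem_kazhdan euler_mem hz (add_zero _).le) (eigenspaces_le hu)
    ((add_mem_cancel_left euler_w).1 (euler_add ▸ zero_mem _)))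

/-- The letters outside the last column are eliminated in order of decreasing column. -/
theorem mem_letterSpan_lastColumn (hv : v ∈ whittakerVectors n) (hvd : v ∈ kazhdan n d) :
    v ∈ letterSpan {x ∈ upperIndices n | (x.2.2 : ℕ) + 1 = n} d ⊔ kazhdan n (d - 1) := by
  classical
  let lastColumn : Set (Fin 2 × Fin n × Fin n) := {x ∈ upperIndices n | (x.2.2 : ℕ) + 1 = n}
  have eliminate (T : Finset (Fin 2 × Fin n × Fin n))
      (hT : ∀ x ∈ T, x ∈ upperIndices n ∧ (x.2.2 : ℕ) + 1 ≠ n)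
      (hvT : v ∈ letterSpan (lastColumn ∪ T) d ⊔ kazhdan n (d - 1)) :
      v ∈ letterSpan lastColumn d ⊔ kazhdan n (d - 1) := by
    induction T using Finset.induction_on_max_value (fun x : Fin 2 × Fin n × Fin n => x.2.2) with
    | empty => simpa using hvT
    | insert x T hx hmax ih =>
      obtain ⟨hxT, hT⟩ := Finset.forall_mem_insert .. |>.1 hT
      refine ih hT (mem_letterSpan_of_mem_letterSpan_insert (p := x.1) ?_ hxT.1 hxT.2 ?_ ?_ hv ?_)
      · exact Set.union_subset (Set.sep_subset _ _) fun y hy => (hT y hy).1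
      · exact fun h => h.elim (fun h => hxT.2 h.2) hx
      · exact fun y hy => hy.imp (fun h => h.2) (hmax y)
      · rwa [Finset.coe_insert, Set.union_insert] at hvT
  refine eliminate {x | x ∈ upperIndices n ∧ (x.2.2 : ℕ) + 1 ≠ n} (by simp)
    (Submodule.mem_sup_left (wordSpan_mono (fun x hx => ?_) le_rfl (kazhdan_le_letterSpan d hvd)))
  by_cases hxn : (x.2.2 : ℕ) + 1 = n
  · exact .inl ⟨hx, hxn⟩
  · exact .inr (by simpa using ⟨hx, hxn⟩)

end Elimination

section CornerSubalgebra

variable {n : ℕ}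

theorem proj_mem_whittakerVectors (u : adInvariants n) : proj n u ∈ whittakerVectors n :=
  wEquiv_invariantsToW u ▸ (wEquiv n (invariantsToW n u)).2

/-- The invariant `e_{n,1}^{(m)}` (for `p = 0`) or `f_{n,1}^{(m)}` (for `p = 1`); the indices are
`n - 1` and `0` because `Fin n` starts at `0`. -/
def cornerInvariant (hn : 0 < n) (m : ℕ) (p : Fin 2) : adInvariants n :=
  ⟨power m p ⟨n - 1, Nat.sub_lt hn one_pos⟩ ⟨0, hn⟩,
    power_mem_adInvariants m p (Nat.sub_add_cancel hn) rfl⟩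

/-- The subalgebra of `U(Q(n))^{ad m}` generated by `e_{n,1}^{(m)}` and `f_{n,1}^{(m)}` with
`n ≤ m ≤ 2n - 1`. -/
def cornerSubalgebra (hn : 0 < n) : Subalgebra ℂ (adInvariants n) :=
  Algebra.adjoin ℂ {u | ∃ m ∈ Finset.Icc n (2 * n - 1), ∃ p, cornerInvariant hn m p = u}

/-- The image of `cornerSubalgebra` in `Q_χ`. -/
def cornerVectors (hn : 0 < n) : Submodule ℂ (WhittakerModule n) :=
  (Subalgebra.toSubmodule (cornerSubalgebra hn)).map
    ((proj n).restrictScalars ℂ ∘ₗ (adInvariants n).val.toLinearMap)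

theorem mem_cornerVectors {hn : 0 < n} {v : WhittakerModule n} :
    v ∈ cornerVectors hn ↔ ∃ u ∈ cornerSubalgebra hn, proj n u = v := Iff.rfl

theorem letterSpan_lastColumn_le_cornerVectors (hn : 0 < n) (d : ℤ) :
    letterSpan {x ∈ upperIndices n | (x.2.2 : ℕ) + 1 = n} d ≤ cornerVectors hn := by
  refine wordSpan_le (fun x hx => degree_pos hx.1) (N := fun _ => cornerVectors hn)
    (fun _ _ => mem_cornerVectors.2 ⟨1, one_mem _, rfl⟩) (fun d ih x hx v hv => ?_) d
  obtain ⟨p, i, j⟩ := x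
  obtain ⟨hij, hj⟩ := hx
  obtain ⟨u, hu, rfl⟩ := mem_cornerVectors.1 (ih _ (sub_lt_self d (degree_pos hij)) hv)
  obtain rfl : j = ⟨n - 1, Nat.sub_lt hn one_pos⟩ := Fin.ext (Nat.eq_sub_of_add_eq hj)
  rw [letter_eq_power p i hj, ← map_smul]
  exact mem_cornerVectors.2 ⟨cornerInvariant hn (2 * n - 1 - i) p * u, mul_mem
    (Algebra.subset_adjoin ⟨_, Finset.mem_Icc.2 ⟨by omega, by omega⟩, p, rfl⟩) hu, rfl⟩

theorem mem_cornerVectors_of_mem_whittakerVectors (hn : 0 < n) {d : ℤ} {v : WhittakerModule n}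
    (hv : v ∈ whittakerVectors n) (hvd : v ∈ kazhdan n d) : v ∈ cornerVectors hn := by
  induction d using Int.strongRec (m := 0) generalizing v with
  | lt d hd =>
    rw [kazhdan, wordSpan_eq_bot_of_neg (fun x hx => (degree_pos hx).le) hd] at hvd
    exact (Submodule.mem_bot ℂ).1 hvd ▸ zero_mem _
  | ge d _ ih =>
    obtain ⟨w, hw, r, hr, rfl⟩ := Submodule.mem_sup.1 (mem_letterSpan_lastColumn hv hvd)
    have w_mem := letterSpan_lastColumn_le_cornerVectors hn d hw
    obtain ⟨u, -, rfl⟩ := mem_cornerVectors.1 w_mem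
    exact add_mem w_mem (ih (d - 1) (sub_one_lt d)
      ((add_mem_cancel_left (proj_mem_whittakerVectors u)).1 hv) hr)

theorem exists_invariantsToW_eq (hn : 0 < n) (w : FiniteW n) :
    ∃ u ∈ cornerSubalgebra hn, invariantsToW n u = w := by
  obtain ⟨d, hd⟩ := exists_mem_kazhdan (wEquiv n w : WhittakerModule n)
  obtain ⟨u, hu, proj_u⟩ := mem_cornerVectors.1
    (mem_cornerVectors_of_mem_whittakerVectors hn (wEquiv n w).2 hd)
  exact ⟨u, hu, (wEquiv n).injective (Subtype.ext ((wEquiv_invariantsToW u).trans proj_u))⟩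

end CornerSubalgebra

end QueerW

end

theorem mainTheorem8 (n : ℕ) (hn : 0 < n) :
    -- the elements `π(e_{n,1}^{(m)})` and `π(f_{n,1}^{(m)})` lie in `W_χ`
    (∀ m ∈ Finset.Icc n (2 * n - 1),
      QueerW.proj n (QueerW.eElt m ⟨n - 1, Nat.sub_lt hn one_pos⟩ ⟨0, hn⟩) ∈
          QueerW.whittakerVectors n ∧
        QueerW.proj n (QueerW.fElt m ⟨n - 1, Nat.sub_lt hn one_pos⟩ ⟨0, hn⟩) ∈
          QueerW.whittakerVectors n) ∧
    -- they generate the algebra `W_χ`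
    Algebra.adjoin ℂ {w : QueerW.FiniteW n | ∃ m ∈ Finset.Icc n (2 * n - 1),
      (QueerW.wEquiv n w : QueerW.WhittakerModule n) =
          QueerW.proj n (QueerW.eElt m ⟨n - 1, Nat.sub_lt hn one_pos⟩ ⟨0, hn⟩) ∨
        (QueerW.wEquiv n w : QueerW.WhittakerModule n) =
          QueerW.proj n (QueerW.fElt m ⟨n - 1, Nat.sub_lt hn one_pos⟩ ⟨0, hn⟩)} = ⊤ ∧
    -- the natural homomorphism `U(Q(n))^{ad m} → W_χ` is surjective
    Function.Surjective (QueerW.invariantsToW n) := by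
  refine ⟨fun m _ => ⟨QueerW.proj_mem_whittakerVectors (QueerW.cornerInvariant hn m 0),
    QueerW.proj_mem_whittakerVectors (QueerW.cornerInvariant hn m 1)⟩,
    eq_top_iff.2 fun w _ => ?_,
    fun w => (QueerW.exists_invariantsToW_eq hn w).imp fun _ hu => hu.2⟩
  obtain ⟨u, hu, rfl⟩ := QueerW.exists_invariantsToW_eq hn w
  refine Algebra.adjoin_le (S := (Algebra.adjoin ℂ _).comap (QueerW.invariantsToW n)) ?_ hu
  rintro _ ⟨m, hm, p, rfl⟩
  refine Algebra.subset_adjoin ⟨m, hm, ?_⟩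
  match p with
  | 0 => exact .inl (QueerW.wEquiv_invariantsToW _)
  | 1 => exact .inr (QueerW.wEquiv_invariantsToW _)
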